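/- **Setting.** Everything is smooth. For a distribution $\mathcal V$ on a manifold put $\mathcal V^{(1)}=\mathcal V+[\mathcal V,\mathcal V]$, $\mathcal V^{(2)}=(\mathcal V^{(1)})^{(1)}$, and let $\operatorname{ch}\mathcal V$ be the Cauchy characteristic distribution, whose fibre at $q$ consists of the values $Y(q)$ of the local sections $Y$ of $\mathcal V$ with $[Y,Z](q)\in\mathcal V_q$ for all local sections $Z$ of $\mathcal V$. Let $n\ge 2$. An *$n$-hyperbolic manifold* $(M,H)$ is a manifold $M$ of dimension $3n+1$ with a distribution $H=H_1\oplus\cdots\oplus H_n$, each $H_i$ of rank $2$, such that $[H_i,H_j]\equiv 0 \bmod H$ for $i\ne j$ and $[H_i,H_i]\equiv Z_i\bmod H$ with $Z_1,\dots,Z_n$ linearly independent modulo $H$, and such that at every point $(\dim H^{(k)},\dim \operatorname{ch}H^{(k)})$ equals $(2n,0)$, $(3n,n)$, $(3n+1,3n+1)$ for $k=0,1,2$. *Adapted coordinates* on an open set $U\subseteq M$ are coordinates $x_1,\dots,x_n,y_0,\dots,y_n,u_1,\dots,u_n$ on $U$ such that $\operatorname{ch}H^{(1)}=\operatorname{span}\{\partial_{u_1},\dots,\partial_{u_n}\}$,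 together with vector fields $X_i\equiv\partial_{x_i}+\sum_{a=0}^n\rho_i^a\,\partial_{y_a}\bmod\{\partial_{u_1},\dots,\partial_{u_n}\}$ such that $\{X_i,\partial_{u_i}\}$ is a basis of $H_i$, $1\le i\le n$; $(M,H)$ is *Darboux integrable* if it has adapted coordinates. A system $u_{x_ix_j}=F_{ij}(x,u,\nabla u)$, $1\le i<j\le n$, with smooth $F_{ij}$ on an open set $W\subseteq J^1(\mathbb R^n,\mathbb R)$, is a *GDMZ system* if the restriction of the contact system of $J^2(\mathbb R^n,\mathbb R)$ to its equation manifold $\mathcal R_F=\{u_{ij}=F_{ij}(x,u,\nabla u),\ i<j\}\subset J^2(\mathbb R^n,\mathbb R)$ (over $W$) is, with independence form $dx_1\wedge\cdots\wedge dx_n$, an involutive linear Pfaffian system in the sense of Cartan: at every point the essential torsion vanishes and the tableau $A$ satisfies Cartan's test $\dim A^{(1)}=\sum_k k\,s_k$. **Theorem.** Let $(M,H)$ be a Darboux integrable $n$-hyperbolic manifold with adapted coordinates $(x,y,u)$ and adapted basis $\{X_i,\partial_{u_i}\}$ on $U$, let $\mathcal A=\operatorname{span}\{\partial_{u_i},[\partial_{u_i},X_i]: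 1\le i\le n\}$, and let $p$ be a function on $U$ such that $x_1,\dots,x_n,p$ span the invariants of $\mathcal A$, i.e. $dx_1,\dots,dx_n,dp$ span the annihilator of $\mathcal A$ at every point. Put $p_i=X_ip$, $p_{ii}=X_ip_i$ and $f_{ij}=X_jp_i$ for $i<j$. Then, on $U$: 1. $\mathcal A$ is an integrable distribution of rank $2n$. 2. $\varphi=(x_1,\dots,x_n,p,p_1,\dots,p_n,p_{11},\dots,p_{nn}):U\to\mathbb R^{3n+1}$ is a local diffeomorphism. 3. The map $\Phi:U\to J^2(\mathbb R^n,\mathbb R)$ given by $u=p$, $u_i=p_i$, $u_{ii}=p_{ii}$, $u_{ij}=f_{ij}$ $(i<j)$ is an immersion, and $H$ is the inverse image under $d\Phi$ of the contact distribution of $J^2(\mathbb R^n,\mathbb R)$. 4. The image of $\Phi$ is locally a GDMZ system: every point of $U$ has an open neighbourhood $N\subseteq U$ on which $\Phi$ is injective and for which there is a GDMZ system $u_{x_ix_j}=F_{ij}(x,u,\nabla u)$, $i<j$, such that $f_{ij}=F_{ij}(x,p,p_1,\dots,p_n)$ on $N$ (so the $f_{ij}$ do not depend on the $p_{ll}$)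 and $\Phi(N)$ is an open subset of the equation manifold $\mathcal R_F$. 5. There are one-forms $\pi^1,\dots,\pi^n,\theta^0,\dots,\theta^n$ which together with $\omega^i=dx_i$ form a coframe, with $\Theta=\{\theta^0,\dots,\theta^n\}=H^\perp$, $\pi^i(X_j)=0$, $\pi^i(\partial_{u_j})=\delta_{ij}$, and $$d\theta^0\equiv 0,\qquad d\theta^i\equiv\pi^i\wedge\omega^i\ (1\le i\le n)\quad\bmod\Theta .$$ 6. $\Theta$, with independence form $dx_1\wedge\cdots\wedge dx_n$, is an involutive linear Pfaffian system: its essential torsion vanishes, its tableau satisfies Cartan's test, and its Cartan characters are $s_1=n$ and $s_k=0$ for $k\ge2$. -/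

import Mathlib

open Set Manifold VectorField
open scoped ContDiff Topology

noncomputable section

namespace NHyp

/-! ## Vector fields and distributions on a manifold -/

section Manifolds

variable {E : Type*} [NormedAddCommGroup E] [NormedSpace ℝ E]
  {M : Type*} [TopologicalSpace M] [ChartedSpace E M]

/-- A (not necessarily smooth) vector field. -/
abbrev VField (E : Type*) [NormedAddCommGroup E] [NormedSpace ℝ E]
    (M : Type*) [TopologicalSpace M] [ChartedSpace E M] :=
  ∀ q : M, TangentSpace 𝓘(ℝ, E) q

/-- A field of tangent subspaces. -/
abbrev Distribution (E : Type*) [NormedAddCommGroup E] [NormedSpace ℝ E]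
    (M : Type*) [TopologicalSpace M] [ChartedSpace E M] :=
  ∀ q : M, Submodule ℝ (TangentSpace 𝓘(ℝ, E) q)

/-- A field of covectors. -/
abbrev OneForm (E : Type*) [NormedAddCommGroup E] [NormedSpace ℝ E]
    (M : Type*) [TopologicalSpace M] [ChartedSpace E M] :=
  ∀ q : M, Module.Dual ℝ (TangentSpace 𝓘(ℝ, E) q)

variable [IsManifold 𝓘(ℝ, E) ∞ M]

/-- `Y` is smooth on `V`, as a section of the tangent bundle. -/
def SmoothOn (Y : VField E M) (V : Set M) : Prop :=
  ContMDiffOn 𝓘(ℝ, E) (𝓘(ℝ, E)).tangent ∞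
    (fun q => (⟨q, Y q⟩ : TangentBundle 𝓘(ℝ, E) M)) V

/-- `Y` is a smooth section of `D` over `V`. -/
def IsSectionOn (D : Distribution E M) (V : Set M) (Y : VField E M) : Prop :=
  SmoothOn Y V ∧ ∀ q ∈ V, Y q ∈ D q

/-- `Y` is a smooth section of `D` over some open neighbourhood of `q`. -/
def IsLocalSection (D : Distribution E M) (q : M) (Y : VField E M) : Prop :=
  ∃ V : Set M, IsOpen V ∧ q ∈ V ∧ IsSectionOn D V Y

/-- The Lie bracket of vector fields. -/
abbrev bracket (Y Z : VField E M) : VField E M := mlieBracket 𝓘(ℝ, E) Y Z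

/-- `D` is a smooth distribution of constant rank `r`: locally spanned by a smooth frame. -/
def IsSmoothOfRank (D : Distribution E M) (r : ℕ) : Prop :=
  ∀ q : M, ∃ V : Set M, IsOpen V ∧ q ∈ V ∧ ∃ Y : Fin r → VField E M,
    (∀ k, SmoothOn (Y k) V) ∧
      ∀ q' ∈ V, LinearIndependent ℝ (fun k => Y k q') ∧
        D q' = Submodule.span ℝ (range fun k => Y k q')

/-- The derived distribution `D + [D, D]`. -/
def derived (D : Distribution E M) : Distribution E M := fun q =>
  D q ⊔ Submodule.span ℝ
    {v | ∃ Y Z : VField E M, IsLocalSection D q Y ∧ IsLocalSection D q Z ∧ v = bracket Y Z q}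

/-- The Cauchy characteristic space of `D` at each point: the values at `q` of the sections `Y`
of `D` near `q` whose brackets with all sections of `D` lie in `D` at `q`.  (These values already
form a subspace.) -/
def cauchy (D : Distribution E M) : Distribution E M := fun q =>
  Submodule.span ℝ
    {v | ∃ Y : VField E M, IsLocalSection D q Y ∧ Y q = v ∧
      ∀ Z : VField E M, IsLocalSection D q Z → bracket Y Z q ∈ D q}

/-- Frobenius integrability (closure of sections under the bracket) over the open set `U`. -/
def IsIntegrableOn (D : Distribution E M) (U : Set M) : Prop :=
  ∀ q ∈ U, ∀ Y Z : VField E M, IsLocalSection D q Y → IsLocalSection D q Z →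
    bracket Y Z q ∈ D q

/-- The differential `df` of a function. -/
def dform (f : M → ℝ) : OneForm E M := fun q =>
  (show TangentSpace 𝓘(ℝ, E) q →L[ℝ] ℝ from mfderiv 𝓘(ℝ, E) 𝓘(ℝ, ℝ) f q).toLinearMap

/-- The derivative `Y f` of the function `f` along the vector field `Y`. -/
def der (Y : VField E M) (f : M → ℝ) : M → ℝ := fun q => dform f q (Y q)

/-- A one-form is smooth on the open set `U` if it maps smooth vector fields to smooth
functions. -/
def SmoothFormOn (θ : OneForm E M) (U : Set M) : Prop :=
  ∀ V : Set M, IsOpen V → V ⊆ U → ∀ Y : VField E M, SmoothOn Y V →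
    ContMDiffOn 𝓘(ℝ, E) 𝓘(ℝ, ℝ) ∞ (fun q => θ q (Y q)) V

/-- The exterior derivative of a one-form:
`dθ(Y, Z) = Y(θ(Z)) - Z(θ(Y)) - θ([Y, Z])`. -/
def extD (θ : OneForm E M) (Y Z : VField E M) (q : M) : ℝ :=
  der Y (fun q' => θ q' (Z q')) q - der Z (fun q' => θ q' (Y q')) q - θ q (bracket Y Z q)

/-- The wedge product `α ∧ β` of one-forms. -/
def wedge (α β : OneForm E M) (Y Z : VField E M) (q : M) : ℝ :=
  α q (Y q) * β q (Z q) - α q (Z q) * β q (Y q)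

/-- The congruence `dθ ≡ Ω mod Θ` over `U`, where `Θ` is the annihilator of `D`: the two-forms
`dθ` and `Ω` agree on sections of `D`. -/
def ExtDCongr (D : Distribution E M) (U : Set M) (θ : OneForm E M)
    (Ω : VField E M → VField E M → M → ℝ) : Prop :=
  ∀ q ∈ U, ∀ Y Z : VField E M, IsLocalSection D q Y → IsLocalSection D q Z →
    extD θ Y Z q = Ω Y Z q

end Manifolds

/-! ## Tableaux, Cartan characters and Cartan's test -/

section Tableaux

variable {n : ℕ} {W : Type*} [AddCommGroup W] [Module ℝ W]

/-- A tableau: a linear space of linear maps `ℝⁿ → W`. -/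
abbrev Tableau (n : ℕ) (W : Type*) [AddCommGroup W] [Module ℝ W] :=
  Submodule ℝ ((Fin n → ℝ) →ₗ[ℝ] W)

/-- Evaluation of a linear map at `k` vectors. -/
def evalAt {k : ℕ} (v : Fin k → Fin n → ℝ) : ((Fin n → ℝ) →ₗ[ℝ] W) →ₗ[ℝ] (Fin k → W) where
  toFun a := fun j => a (v j)
  map_add' _ _ := rfl
  map_smul' _ _ := rfl

/-- `s₁ + ⋯ + s_k`: the rank of the evaluation of the tableau at `k` generic vectors, that is,
the largest such rank. -/
def characterSum (A : Tableau n W) (k : ℕ) : ℕ :=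
  ⨆ v : Fin k → Fin n → ℝ, Module.finrank ℝ (A.map (evalAt v))

/-- The Cartan character `s_k`, for `k ≥ 1`. -/
def character (A : Tableau n W) (k : ℕ) : ℕ :=
  characterSum A k - characterSum A (k - 1)

/-- The first prolongation of the tableau `A`: linear maps `P : ℝⁿ → A` with
`P v w = P w v`. -/
def prolongation (A : Tableau n W) :
    Submodule ℝ ((Fin n → ℝ) →ₗ[ℝ] (Fin n → ℝ) →ₗ[ℝ] W) where
  carrier := {P | (∀ v, P v ∈ A) ∧ ∀ v w, P v w = P w v}
  zero_mem' := ⟨fun _ => A.zero_mem, fun _ _ => rfl⟩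
  add_mem' := fun {P Q} hP hQ => ⟨fun v => A.add_mem (hP.1 v) (hQ.1 v), fun v w => by
    simp [hP.2 v w, hQ.2 v w]⟩
  smul_mem' := fun c P hP => ⟨fun v => A.smul_mem c (hP.1 v), fun v w => by
    simp [hP.2 v w]⟩

/-- Cartan's test: `dim A⁽¹⁾ = s₁ + 2 s₂ + ⋯ + n s_n`. -/
def CartanTest (A : Tableau n W) : Prop :=
  Module.finrank ℝ (prolongation A) = ∑ k ∈ Finset.Icc 1 n, k * character A k

end Tableaux

/-! ## Linear Pfaffian systems

The Pfaffian system is `I = D^⊥`, for a distribution `D`, with independence forms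
`ω₁, …, ω_n`. -/

section Pfaffian

variable {E : Type*} [NormedAddCommGroup E] [NormedSpace ℝ E]
  {M : Type*} [TopologicalSpace M] [ChartedSpace E M] [IsManifold 𝓘(ℝ, E) ∞ M] {n : ℕ}

/-- The system is a linear Pfaffian system with independence condition at `q`: the independence
forms are independent on `D`, and `dI ≡ 0 mod (I, ω₁, …, ω_n)`, that is, brackets of sections of
`D` whose values at `q` are killed by all `ω_i` lie in `D`. -/
def IsLinearPfaffianAt (D : Distribution E M) (om : Fin n → OneForm E M) (q : M) : Prop :=
  (∀ c : Fin n → ℝ, ∃ v ∈ D q, ∀ i, om i q v = c i) ∧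
    ∀ Y Z : VField E M, IsLocalSection D q Y → IsLocalSection D q Z →
      (∀ i, om i q (Y q) = 0) → (∀ i, om i q (Z q) = 0) → bracket Y Z q ∈ D q

/-- The tableau of the system at `q`.  A vector `v = Y(q)` of `D` that is killed by all `ω_i`
defines the linear map `ω(Z) ↦ [Y, Z] mod D` from `ℝⁿ` to `T_qM / D_q`. -/
def tableau (D : Distribution E M) (om : Fin n → OneForm E M) (q : M) :
    Tableau n (TangentSpace 𝓘(ℝ, E) q ⧸ D q) :=
  Submodule.span ℝ
    {a | ∃ Y : VField E M, IsLocalSection D q Y ∧ (∀ i, om i q (Y q) = 0) ∧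
      ∀ Z : VField E M, IsLocalSection D q Z →
        a (fun i => om i q (Z q)) = (D q).mkQ (bracket Y Z q)}

/-- The (essential) torsion vanishes at `q`: a complement of the space of vectors of `D` killed by
the `ω_i` can be chosen in `D` on which the torsion is zero; equivalently there is an integral
element at `q` on which `ω₁, …, ω_n` are independent. -/
def TorsionVanishesAt (D : Distribution E M) (om : Fin n → OneForm E M) (q : M) : Prop :=
  ∃ Z : Fin n → VField E M, (∀ i, IsLocalSection D q (Z i)) ∧
    (∀ i j, om j q (Z i q) = if i = j then 1 else 0) ∧
    ∀ i j, bracket (Z i) (Z j) q ∈ D q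

/-- Involutivity, in the sense of Cartan, of the linear Pfaffian system at `q`. -/
def IsInvolutiveAt (D : Distribution E M) (om : Fin n → OneForm E M) (q : M) : Prop :=
  IsLinearPfaffianAt D om q ∧ TorsionVanishesAt D om q ∧ CartanTest (tableau D om q)

end Pfaffian

/-! ## Jet spaces and generalised Darboux-Manakov-Zakharov systems -/

section Jets

/-- The jet space `J¹(ℝⁿ, ℝ)`, with coordinates `(x_i, u, u_i)`. -/
abbrev J1 (n : ℕ) := (Fin n → ℝ) × ℝ × (Fin n → ℝ)

/-- The jet space `J²(ℝⁿ, ℝ)`, with coordinates `(x_i, u, u_i, u_{ij})`; the second derivatives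
are indexed by unordered pairs. -/
abbrev J2 (n : ℕ) := (Fin n → ℝ) × ℝ × (Fin n → ℝ) × (Sym2 (Fin n) → ℝ)

/-- The space of the variables `(x_i, u, u_i, u_{ii})`. -/
abbrev JDiag (n : ℕ) := (Fin n → ℝ) × ℝ × (Fin n → ℝ) × (Fin n → ℝ)

/-- The projection `J² → J¹`. -/
def J2.toJ1 {n : ℕ} (z : J2 n) : J1 n := (z.1, z.2.1, z.2.2.1)

/-- The projection that forgets the pure second derivatives. -/
def JDiag.toJ1 {n : ℕ} (z : JDiag n) : J1 n := (z.1, z.2.1, z.2.2.1)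

/-- The contact distribution on `J²`: the common kernel of `du - ∑ u_i dx_i` and
`du_i - ∑ u_{ij} dx_j`. -/
def contact (n : ℕ) : Distribution (J2 n) (J2 n) := fun z =>
  { carrier := {v : J2 n | v.2.1 = ∑ i, z.2.2.1 i * v.1 i ∧
      ∀ i, v.2.2.1 i = ∑ j, z.2.2.2 s(i, j) * v.1 j}
    zero_mem' := by
      constructor
      · change (0 : ℝ) = ∑ i, z.2.2.1 i * (0 : ℝ)
        simp
      · intro i
        change (0 : ℝ) = ∑ j, z.2.2.2 s(i, j) * (0 : ℝ)
        simp
    add_mem' := by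
      intro (v : J2 n) (w : J2 n) hv hw
      constructor
      · change v.2.1 + w.2.1 = ∑ i, z.2.2.1 i * (v.1 i + w.1 i)
        rw [hv.1, hw.1, ← Finset.sum_add_distrib]
        simp only [mul_add]
      · intro i
        change v.2.2.1 i + w.2.2.1 i = ∑ j, z.2.2.2 s(i, j) * (v.1 j + w.1 j)
        rw [hv.2 i, hw.2 i, ← Finset.sum_add_distrib]
        simp only [mul_add]
    smul_mem' := by
      intro c (v : J2 n) hv
      constructor
      · change c * v.2.1 = ∑ i, z.2.2.1 i * (c * v.1 i)
        rw [hv.1, Finset.mul_sum]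
        exact Finset.sum_congr rfl fun i _ => by ring
      · intro i
        change c * v.2.2.1 i = ∑ j, z.2.2.2 s(i, j) * (c * v.1 j)
        rw [hv.2 i, Finset.mul_sum]
        exact Finset.sum_congr rfl fun j _ => by ring }

variable {n : ℕ}

/-- The submanifold of `J²` defined by the equations `u_{ij} = F_{ij}(x, u, ∇u)`, `i < j`, with
right-hand sides defined for `(x, u, ∇u) ∈ W`. -/
def equationManifold (W : Set (J1 n)) (F : Fin n → Fin n → J1 n → ℝ) : Set (J2 n) :=
  {z | z.toJ1 ∈ W ∧ ∀ i j, i < j → z.2.2.2 s(i, j) = F i j z.toJ1}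

/-- The parametrisation of the equation manifold by `(x_i, u, u_i, u_{ii})`. -/
def equationParam (F : Fin n → Fin n → J1 n → ℝ) (z : JDiag n) : J2 n :=
  (z.1, z.2.1, z.2.2.1, fun s =>
    if s.inf = s.sup then z.2.2.2 s.inf else F s.inf s.sup z.toJ1)

/-- `equationParam` maps the points over `W` onto the equation manifold. -/
theorem equationParam_image (W : Set (J1 n)) (F : Fin n → Fin n → J1 n → ℝ) :
    equationParam F '' {z | z.toJ1 ∈ W} = equationManifold W F := by
  ext z
  constructor
  · rintro ⟨w, hw, rfl⟩
    refine ⟨hw, fun i j hij => ?_⟩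
    have h1 : i ⊓ j = i := inf_eq_left.2 hij.le
    have h2 : i ⊔ j = j := sup_eq_right.2 hij.le
    simp only [equationParam, Sym2.inf_mk, Sym2.sup_mk, h1, h2, if_neg hij.ne]
    rfl
  · rintro ⟨hz, h⟩
    refine ⟨(z.1, z.2.1, z.2.2.1, fun i => z.2.2.2 s(i, i)), hz, ?_⟩
    refine Prod.ext rfl (Prod.ext rfl (Prod.ext rfl ?_))
    funext s
    induction s using Sym2.ind with
    | _ a b =>
      rcases lt_trichotomy a b with hab | hab | hab
      · have h1 : a ⊓ b = a := inf_eq_left.2 hab.le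
        have h2 : a ⊔ b = b := sup_eq_right.2 hab.le
        simp only [equationParam, Sym2.inf_mk, Sym2.sup_mk, h1, h2, if_neg hab.ne]
        exact (h a b hab).symm
      · subst hab
        simp [equationParam]
      · have h1 : a ⊓ b = b := inf_eq_right.2 hab.le
        have h2 : a ⊔ b = a := sup_eq_left.2 hab.le
        simp only [equationParam, Sym2.inf_mk, Sym2.sup_mk, h1, h2, if_neg hab.ne]
        rw [Sym2.eq_swap]
        exact (h b a hab).symm

/-- The restriction of the contact distribution to the equation manifold, in the parameters
`(x_i, u, u_i, u_{ii})`. -/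
def equationDistribution (F : Fin n → Fin n → J1 n → ℝ) : Distribution (JDiag n) (JDiag n) :=
  fun z => (contact n (equationParam F z)).comap
    (mfderiv 𝓘(ℝ, JDiag n) 𝓘(ℝ, J2 n) (equationParam F) z :
      TangentSpace 𝓘(ℝ, JDiag n) z →ₗ[ℝ] TangentSpace 𝓘(ℝ, J2 n) (equationParam F z))

/-- The system `u_{ij} = F_{ij}(x, u, ∇u)`, `i < j`, with smooth right-hand sides on the open set
`W`, is a generalised Darboux-Manakov-Zakharov system: the contact system, restricted to the
equation manifold and with independence forms `dx_1, …, dx_n`, is involutive at every point. -/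
def IsGDMZ (W : Set (J1 n)) (F : Fin n → Fin n → J1 n → ℝ) : Prop :=
  IsOpen W ∧ (∀ i j, i < j → ContDiffOn ℝ ∞ (F i j) W) ∧
    ∀ z : JDiag n, z.toJ1 ∈ W →
      IsInvolutiveAt (equationDistribution F)
        (fun i => dform (E := JDiag n) (fun z' : JDiag n => z'.1 i)) z

end Jets

/-! ## n-hyperbolic manifolds and adapted coordinates -/

section Hyperbolic

variable {E : Type*} [NormedAddCommGroup E] [NormedSpace ℝ E]
  {M : Type*} [TopologicalSpace M] [ChartedSpace E M] [IsManifold 𝓘(ℝ, E) ∞ M] {n : ℕ}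

/-- `H = H_1 + ⋯ + H_n`. -/
def total (Hs : Fin n → Distribution E M) : Distribution E M := fun q => ⨆ i, Hs i q

/-- `M`, with the distribution `H = H_1 ⊕ ⋯ ⊕ H_n`, is an `n`-hyperbolic manifold. -/
structure IsNHyperbolic (Hs : Fin n → Distribution E M) : Prop where
  dim_eq : Module.finrank ℝ E = 3 * n + 1
  rank_two : ∀ i, IsSmoothOfRank (Hs i) 2
  direct_sum : ∀ q, iSupIndep fun i => Hs i q
  /-- `[H_i, H_j] ≡ 0 mod H` for `i ≠ j` -/
  bracket_ne : ∀ i j, i ≠ j → ∀ q, ∀ Y Z : VField E M,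
    IsLocalSection (Hs i) q Y → IsLocalSection (Hs j) q Z → bracket Y Z q ∈ total Hs q
  /-- `[H_i, H_i] ≡ Z_i mod H` with `Z_1 ∧ ⋯ ∧ Z_n ≠ 0` modulo `H` -/
  bracket_self : ∀ q, ∃ Z : Fin n → TangentSpace 𝓘(ℝ, E) q,
    LinearIndependent ℝ (fun i => (total Hs q).mkQ (Z i)) ∧
    ∀ i, total Hs q ⊔ Submodule.span ℝ {v | ∃ Y Y' : VField E M, IsLocalSection (Hs i) q Y ∧
        IsLocalSection (Hs i) q Y' ∧ v = bracket Y Y' q} =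
      total Hs q ⊔ Submodule.span ℝ {Z i}
  /-- the derived type is `[[2n, 0], [3n, n], [3n + 1, 3n + 1]]` -/
  rank_zero : ∀ q, Module.finrank ℝ (total Hs q) = 2 * n
  cauchy_zero : ∀ q, Module.finrank ℝ (cauchy (total Hs) q) = 0
  rank_one : ∀ q, Module.finrank ℝ (derived (total Hs) q) = 3 * n
  cauchy_one : ∀ q, Module.finrank ℝ (cauchy (derived (total Hs)) q) = n
  rank_derived_two : ∀ q, Module.finrank ℝ (derived (derived (total Hs)) q) = 3 * n + 1
  cauchy_derived_two :
    ∀ q, Module.finrank ℝ (cauchy (derived (derived (total Hs))) q) = 3 * n + 1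

/-- The space of the adapted coordinates `(x_1, …, x_n, y_0, …, y_n, u_1, …, u_n)`. -/
abbrev Coord (n : ℕ) := (Fin n → ℝ) × (Fin (n + 1) → ℝ) × (Fin n → ℝ)

/-- A system of smooth local coordinates `(x, y, u)` on `M`. -/
abbrev CoordSystem (n : ℕ) (E : Type*) [NormedAddCommGroup E] [NormedSpace ℝ E]
    (M : Type*) [TopologicalSpace M] [ChartedSpace E M] :=
  PartialDiffeomorph 𝓘(ℝ, E) 𝓘(ℝ, Coord n) M (Coord n) ∞

/-- The coordinate vector field of `χ` in the constant direction `c`: `q ↦ (dχ_q)⁻¹ c`. -/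
def coordField (χ : CoordSystem n E M) (c : Coord n) : VField E M :=
  mpullback 𝓘(ℝ, E) 𝓘(ℝ, Coord n) χ (fun _ => c)

/-- The coordinate function `x_i`. -/
def xfun (χ : CoordSystem n E M) (i : Fin n) : M → ℝ := fun q => (χ q).1 i

/-- The coordinate vector field `∂/∂x_i`. -/
def ddx (χ : CoordSystem n E M) (i : Fin n) : VField E M :=
  coordField χ (Pi.single i 1, 0, 0)

/-- The coordinate vector field `∂/∂y_a`. -/
def ddy (χ : CoordSystem n E M) (a : Fin (n + 1)) : VField E M :=
  coordField χ (0, Pi.single a 1, 0)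

/-- The coordinate vector field `∂/∂u_i`. -/
def ddu (χ : CoordSystem n E M) (i : Fin n) : VField E M :=
  coordField χ (0, 0, Pi.single i 1)

/-- The coordinates `χ = (x, y, u)`, with domain `U = χ.source`, are adapted to the
`n`-hyperbolic structure, with adapted basis `X_1, …, X_n, ∂/∂u_1, …, ∂/∂u_n`.  The manifold is
Darboux integrable when it has such coordinates. -/
structure IsAdapted (Hs : Fin n → Distribution E M) (χ : CoordSystem n E M)
    (X : Fin n → VField E M) : Prop where
  /-- `ch H⁽¹⁾ = {∂/∂u_1, …, ∂/∂u_n}` -/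
  cauchy_eq : ∀ q ∈ χ.source,
    cauchy (derived (total Hs)) q = Submodule.span ℝ (range fun i => ddu χ i q)
  smooth : ∀ i, SmoothOn (X i) χ.source
  /-- `X_i = ∂/∂x_i + ∑ ρ^a_i ∂/∂y_a mod {∂/∂u_1, …, ∂/∂u_n}` -/
  form : ∀ i, ∀ q ∈ χ.source, ∃ (ρ : Fin (n + 1) → ℝ) (σ : Fin n → ℝ),
    X i q = ddx χ i q + ∑ a, ρ a • ddy χ a q + ∑ k, σ k • ddu χ k q
  /-- `{X_i, ∂/∂u_i}` is a basis of `H_i` -/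
  basis : ∀ i, ∀ q ∈ χ.source, LinearIndependent ℝ ![X i q, ddu χ i q] ∧
    Hs i q = Submodule.span ℝ {X i q, ddu χ i q}

/-- The distribution `𝒜` spanned by `∂/∂u_i` and `[∂/∂u_i, X_i]`, `1 ≤ i ≤ n`. -/
def calA (χ : CoordSystem n E M) (X : Fin n → VField E M) : Distribution E M := fun q =>
  Submodule.span ℝ (range (fun i => ddu χ i q) ∪ range (fun i => bracket (ddu χ i) (X i) q))

/-- The functions `x_1, …, x_n, p` span the invariants of `𝒜`: `p` is smooth and
`dx_1, …, dx_n, dp` span the annihilator of `𝒜` at every point of the coordinate domain. -/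
def SpansInvariants (χ : CoordSystem n E M) (X : Fin n → VField E M) (p : M → ℝ) : Prop :=
  ContMDiffOn 𝓘(ℝ, E) 𝓘(ℝ, ℝ) ∞ p χ.source ∧
    ∀ q ∈ χ.source,
      Submodule.span ℝ (range (fun i => dform (xfun χ i) q) ∪ {dform p q}) =
        (calA χ X q).dualAnnihilator

/-- `p_i = X_i p`. -/
def p1 (X : Fin n → VField E M) (p : M → ℝ) (i : Fin n) : M → ℝ := der (X i) p

/-- `X_j p_i`, which is `p_{ii}` for `i = j` and `f_{ij}` for `i < j`. -/
def p2 (X : Fin n → VField E M) (p : M → ℝ) (i j : Fin n) : M → ℝ := der (X j) (p1 X p i)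

/-- The map `φ = (x_i, p, p_i, p_{ii})`. -/
def phi (χ : CoordSystem n E M) (X : Fin n → VField E M) (p : M → ℝ) : M → JDiag n := fun q =>
  (fun i => xfun χ i q, p q, fun i => p1 X p i q, fun i => p2 X p i i q)

/-- The map `Φ : M → J²` with `u = p`, `u_i = p_i`, `u_{ii} = p_{ii}`, and `u_{ij} = f_{ij}` for
`i < j`. -/
def Phi (χ : CoordSystem n E M) (X : Fin n → VField E M) (p : M → ℝ) : M → J2 n := fun q =>
  (fun i => xfun χ i q, p q, fun i => p1 X p i q, fun s => p2 X p s.inf s.sup q)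

/-- The differential of `Φ`. -/
def dPhi (χ : CoordSystem n E M) (X : Fin n → VField E M) (p : M → ℝ) (q : M) :
    TangentSpace 𝓘(ℝ, E) q →ₗ[ℝ] TangentSpace 𝓘(ℝ, J2 n) (Phi χ X p q) :=
  (mfderiv 𝓘(ℝ, E) 𝓘(ℝ, J2 n) (Phi χ X p) q :
    TangentSpace 𝓘(ℝ, E) q →ₗ[ℝ] TangentSpace 𝓘(ℝ, J2 n) (Phi χ X p q))

end Hyperbolic

end NHyp

end

open NHyp

/-! Everything follows from differentiating the invariant `p` along the adapted frame. Modulo the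
span of the ∂/∂u_k the fields X_i commute with each other, and ∂/∂u_k commutes with X_i for k ≠ i:
these brackets lie in H by hyperbolicity and annihilate every x_j. Since 𝒜 annihilates p, the
functions p_i = X_i p are constant along all ∂/∂u_k, and X_j p_i = X_i p_j. So H lies in the kernel
of the contact forms dp - ∑ p_i dx_i and dp_i - ∑ p_ij dx_j. The same argument one order higher,
combined with p_ij = p_ji, shows that ∂/∂u_k moves p_ij only if i = j = k, at the rate a_i =
[∂/∂u_i, X_i] p_i (`dpSym_ddu`).

The crucial point is a_i ≠ 0 (`aFun_ne_zero`). Since H⁽¹⁾ is the kernel of dp - ∑ p_i dx_i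
(`mem_derived_iff`), at a zero of a_i the bracket [∂/∂u_i, X_i] would be a Cauchy characteristic
vector of H⁽¹⁾ outside the span of the ∂/∂u_k. Hence H is exactly the contact kernel
(`isJetSystem`), the differentials of x_i, p, p_i, p_ii have no common kernel, and the inverse
function theorem applies.

The structure equations and involutivity rest on the bracket computation behind [Y, Z] ≡ ∑ (π_i ∧
dx_i)(Y, Z) B_i mod D (`mkQ_bracket`). It makes the tableau diagonal, and diagonal tableaux pass
Cartan's test with s_1 = n as only nonzero character. The formula is proved for an abstract frame
(`IsJetFrameAt`) because it is used twice: for H itself, and for the contact system on an equation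
manifold u_ij = F_ij. In the second case a frame exists as soon as D_k F_ij = D_j F_ik for distinct
i, j, k (`isGDMZ_of_compatible`). On the image of Φ these conditions express X_k p_ij = X_j p_ik,
and they extend to whole fibres over the first-order jets because they are affine in the u_ll
(`compatible_of_ball`). -/

namespace NHyp

/-! ### Vector fields as derivations, and the bracket as a commutator -/

section Calculus

variable {E : Type*} [NormedAddCommGroup E] [NormedSpace ℝ E]
  {M : Type*} [TopologicalSpace M] [ChartedSpace E M]

theorem mdifferentiableAt_of_smooth {f : M → ℝ} {V : Set M} (hV : IsOpen V)
    (hf : ContMDiffOn 𝓘(ℝ, E) 𝓘(ℝ, ℝ) ∞ f V) {q : M} (hq : q ∈ V) :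
    MDifferentiableAt 𝓘(ℝ, E) 𝓘(ℝ, ℝ) f q :=
  (hf.contMDiffAt (hV.mem_nhds hq)).mdifferentiableAt (by simp)

/-- The tangent space at `q` is the model space read in the preferred chart at `q`, so no transition
derivative enters. Pointwise identities for `dform` thus reduce to calculus in `E`. -/
theorem dform_eq_fderiv_chart {f : M → ℝ} {q : M}
    (hf : MDifferentiableAt 𝓘(ℝ, E) 𝓘(ℝ, ℝ) f q) (v : TangentSpace 𝓘(ℝ, E) q) :
    dform f q v = fderiv ℝ (f ∘ (extChartAt 𝓘(ℝ, E) q).symm) (extChartAt 𝓘(ℝ, E) q q) v := by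
  have h : mfderiv 𝓘(ℝ, E) 𝓘(ℝ, ℝ) f q =
      fderiv ℝ (f ∘ (extChartAt 𝓘(ℝ, E) q).symm) (extChartAt 𝓘(ℝ, E) q q) := by
    rw [hf.mfderiv]
    simp only [writtenInExtChartAt, modelWithCornersSelf_coe, range_id,
      fderivWithin_univ, extChartAt_model_space_eq_id, PartialEquiv.refl_coe, Function.id_comp]
    rfl
  exact congrArg (fun L : E →L[ℝ] ℝ => L v) h

variable [IsManifold 𝓘(ℝ, E) ∞ M]

/-- The function Yf is the section Y followed by the tangent map of f and the projection to the
fibre ℝ, and each of the three is smooth. -/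
theorem contMDiffOn_der {Y : VField E M} {f : M → ℝ} {V : Set M} (hV : IsOpen V)
    (hY : SmoothOn Y V) (hf : ContMDiffOn 𝓘(ℝ, E) 𝓘(ℝ, ℝ) ∞ f V) :
    ContMDiffOn 𝓘(ℝ, E) 𝓘(ℝ, ℝ) ∞ (der Y f) V := by
  have h1 : ContMDiffOn (𝓘(ℝ, E)).tangent (𝓘(ℝ, ℝ)).tangent ∞
      (tangentMapWithin 𝓘(ℝ, E) 𝓘(ℝ, ℝ) f V) (Bundle.TotalSpace.proj ⁻¹' V) :=
    hf.contMDiffOn_tangentMapWithin (by simp) hV.uniqueMDiffOn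
  have h2 := h1.comp hY (fun q hq => hq)
  have h3 := (contMDiff_snd_tangentBundle_modelSpace ℝ 𝓘(ℝ, ℝ) (n := ∞)).comp_contMDiffOn h2
  refine h3.congr fun q hq => ?_
  exact congrArg (fun L : TangentSpace 𝓘(ℝ, E) q →L[ℝ] TangentSpace 𝓘(ℝ, ℝ) (f q) => L (Y q))
    (mfderivWithin_of_isOpen hV hq).symm

theorem SmoothOn.bracket [CompleteSpace E] {Y Z : VField E M} {V : Set M} (hV : IsOpen V)
    (hY : SmoothOn Y V) (hZ : SmoothOn Z V) : SmoothOn (bracket Y Z) V := by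
  intro q hq
  refine ContMDiffAt.contMDiffWithinAt ?_
  have : IsManifold 𝓘(ℝ, E) (((⊤ : ℕ∞) : WithTop ℕ∞) + 1) M := by simpa
  have : IsManifold 𝓘(ℝ, E) (minSmoothness ℝ 2) M := by
    rw [minSmoothness_of_isRCLikeNormedField]; infer_instance
  exact ContMDiffAt.mlieBracket_vectorField (m := ⊤) (n := ⊤)
    (hY.contMDiffAt (hV.mem_nhds hq)) (hZ.contMDiffAt (hV.mem_nhds hq)) (by simp)

/-- A vector field in the chart at `q`, acting on the local representative of `f`. -/
theorem eventually_fderiv_chart {f : M → ℝ} {V : Set M} (hV : IsOpen V)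
    (hf : ContMDiffOn 𝓘(ℝ, E) 𝓘(ℝ, ℝ) ∞ f V) {q : M} (hq : q ∈ V) (Y : VField E M) :
    (fun y => fderiv ℝ (f ∘ (extChartAt 𝓘(ℝ, E) q).symm) y
      (mpullbackWithin 𝓘(ℝ, E) 𝓘(ℝ, E) (extChartAt 𝓘(ℝ, E) q).symm Y univ y)) =ᶠ[𝓝
        (extChartAt 𝓘(ℝ, E) q q)] (der Y f) ∘ (extChartAt 𝓘(ℝ, E) q).symm := by
  have ho : IsOpen ((extChartAt 𝓘(ℝ, E) q).target ∩ (extChartAt 𝓘(ℝ, E) q).symm ⁻¹' V) :=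
    (continuousOn_extChartAt_symm q).isOpen_inter_preimage (isOpen_extChartAt_target q) hV
  filter_upwards [ho.mem_nhds ⟨mem_extChartAt_target q, by simpa using hq⟩] with y hy
  have hs : MDifferentiableAt 𝓘(ℝ, E) 𝓘(ℝ, E) (extChartAt 𝓘(ℝ, E) q).symm y := by
    have := mdifferentiableWithinAt_extChartAt_symm (I := 𝓘(ℝ, E)) hy.1
    simpa [mdifferentiableWithinAt_univ] using this
  have hi : (mfderiv 𝓘(ℝ, E) 𝓘(ℝ, E) (extChartAt 𝓘(ℝ, E) q).symm y).IsInvertible := by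
    have := isInvertible_mfderivWithin_extChartAt_symm (I := 𝓘(ℝ, E)) hy.1
    simpa [mfderivWithin_univ] using this
  have hc := mfderiv_comp y (mdifferentiableAt_of_smooth hV hf hy.2) hs
  rw [mfderiv_eq_fderiv] at hc
  rw [mpullbackWithin_univ, mpullback_apply]
  simp only [der, dform, Function.comp_apply]
  have h2 := congrArg (fun L => L ((mfderiv 𝓘(ℝ, E) 𝓘(ℝ, E)
    (extChartAt 𝓘(ℝ, E) q).symm y).inverse (Y ((extChartAt 𝓘(ℝ, E) q).symm y)))) hc
  refine h2.trans ?_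
  obtain ⟨L, hL⟩ := hi
  refine congrArg (mfderiv 𝓘(ℝ, E) 𝓘(ℝ, ℝ) f ((extChartAt 𝓘(ℝ, E) q).symm y)) ?_
  rw [← hL, ContinuousLinearMap.inverse_equiv]
  exact L.apply_symm_apply _

/-- The bracket of vector fields acts on functions as the commutator. -/
theorem der_bracket [CompleteSpace E] {Y Z : VField E M} {f : M → ℝ} {V : Set M} (hV : IsOpen V)
    (hY : SmoothOn Y V) (hZ : SmoothOn Z V) (hf : ContMDiffOn 𝓘(ℝ, E) 𝓘(ℝ, ℝ) ∞ f V)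
    {q : M} (hq : q ∈ V) :
    der (bracket Y Z) f q = der Y (der Z f) q - der Z (der Y f) q := by
  have hmY := (hY.contMDiffAt (hV.mem_nhds hq)).mdifferentiableAt (by simp)
  have hmZ := (hZ.contMDiffAt (hV.mem_nhds hq)).mdifferentiableAt (by simp)
  have hdY : DifferentiableAt ℝ (mpullbackWithin 𝓘(ℝ, E) 𝓘(ℝ, E)
      (extChartAt 𝓘(ℝ, E) q).symm Y univ) (extChartAt 𝓘(ℝ, E) q q) := by
    rw [← mdifferentiableWithinAt_univ] at hmY
    have h := hmY.differentiableWithinAt_mpullbackWithin_vectorField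
    rw [modelWithCornersSelf_coe, range_id, preimage_univ, univ_inter] at h
    exact differentiableWithinAt_univ.1 h
  have hdZ : DifferentiableAt ℝ (mpullbackWithin 𝓘(ℝ, E) 𝓘(ℝ, E)
      (extChartAt 𝓘(ℝ, E) q).symm Z univ) (extChartAt 𝓘(ℝ, E) q q) := by
    rw [← mdifferentiableWithinAt_univ] at hmZ
    have h := hmZ.differentiableWithinAt_mpullbackWithin_vectorField
    rw [modelWithCornersSelf_coe, range_id, preimage_univ, univ_inter] at h
    exact differentiableWithinAt_univ.1 h
  have hcf : ContDiffAt ℝ ∞ (f ∘ (extChartAt 𝓘(ℝ, E) q).symm) (extChartAt 𝓘(ℝ, E) q q) := by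
    have h := (contMDiffAt_iff.1 (hf.contMDiffAt (hV.mem_nhds hq))).2
    rw [modelWithCornersSelf_coe, range_id, contDiffWithinAt_univ] at h
    simpa only [extChartAt_model_space_eq_id, PartialEquiv.refl_coe, Function.id_comp] using h
  -- In the chart the claim is the commutator identity in a vector space. The inner derivatives
  -- agree with Zf and Yf on a neighbourhood, as needed for differentiating once more.
  have hb := fderiv_apply_lieBracket hcf 
    (by rw [minSmoothness_of_isRCLikeNormedField]; exact WithTop.coe_le_coe.2 le_top) hdZ hdY
  rw [(eventually_fderiv_chart hV hf hq Z).fderiv_eq,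
    (eventually_fderiv_chart hV hf hq Y).fderiv_eq] at hb
  have e1 : bracket Y Z q = lieBracket ℝ
      (mpullbackWithin 𝓘(ℝ, E) 𝓘(ℝ, E) (extChartAt 𝓘(ℝ, E) q).symm Y univ)
      (mpullbackWithin 𝓘(ℝ, E) 𝓘(ℝ, E) (extChartAt 𝓘(ℝ, E) q).symm Z univ)
      (extChartAt 𝓘(ℝ, E) q q) := by
    rw [bracket, mlieBracket, mlieBracketWithin_apply, modelWithCornersSelf_coe, range_id,
      preimage_univ, univ_inter, mfderiv_extChartAt_self]
    exact (congrArg (fun L : E →L[ℝ] E => L _) ContinuousLinearMap.inverse_id).trans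
      (congrFun lieBracketWithin_univ _)
  -- The preferred chart at `q` has identity derivative at `q`, so pulling back does not change the
  -- value there.
  have e2 : ∀ Y : VField E M, mpullbackWithin 𝓘(ℝ, E) 𝓘(ℝ, E) (extChartAt 𝓘(ℝ, E) q).symm Y univ
      (extChartAt 𝓘(ℝ, E) q q) = Y q := by
    intro Y
    have := mfderivWithin_range_extChartAt_symm (I := 𝓘(ℝ, E)) (x := q)
    simp only [modelWithCornersSelf_coe, range_id] at this
    rw [mpullbackWithin_apply, this, extChartAt_to_inv]
    exact congrArg (fun L : E →L[ℝ] E => L _) ContinuousLinearMap.inverse_id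
  rw [e2, e2] at hb
  simp only [der]
  rw [dform_eq_fderiv_chart (mdifferentiableAt_of_smooth hV hf hq),
    dform_eq_fderiv_chart (mdifferentiableAt_of_smooth hV (contMDiffOn_der hV hZ hf) hq),
    dform_eq_fderiv_chart (mdifferentiableAt_of_smooth hV (contMDiffOn_der hV hY hf) hq), e1]
  exact hb

end Calculus

/-! ### Diagonal tableaux: characters, prolongation, Cartan's test -/

section DiagonalTableaux

variable {n : ℕ} {W : Type*} [AddCommGroup W] [Module ℝ W]

/-- The linear map `c ↦ ∑ v_i c_i b_i`, as a function of `v`. -/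
def diagMap (b : Fin n → W) : (Fin n → ℝ) →ₗ[ℝ] (Fin n → ℝ) →ₗ[ℝ] W :=
  LinearMap.mk₂ ℝ (fun v c => ∑ i, (v i * c i) • b i)
    (fun v v' c => by simp [add_mul, add_smul, Finset.sum_add_distrib])
    (fun r v c => by simp [Finset.smul_sum, mul_smul])
    (fun v c c' => by simp [mul_add, add_smul, Finset.sum_add_distrib])
    (fun r v c => by simp [Finset.smul_sum, mul_smul, smul_comm _ r])

theorem diagMap_apply (b : Fin n → W) (v c : Fin n → ℝ) :
    diagMap b v c = ∑ i, (v i * c i) • b i := rfl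

theorem diagMap_single_right (b : Fin n → W) (v : Fin n → ℝ) (j : Fin n) :
    diagMap b v (Pi.single j 1) = v j • b j := by
  rw [diagMap_apply, Finset.sum_eq_single j] <;> simp +contextual

theorem eq_of_sum_smul_eq {b : Fin n → W} (hb : LinearIndependent ℝ b) {v w : Fin n → ℝ}
    (h : ∑ i, v i • b i = ∑ i, w i • b i) : v = w := by
  have := Fintype.linearIndependent_iff.1 hb (fun i => v i - w i)
    (by simp [sub_smul, Finset.sum_sub_distrib, h])
  exact funext fun i => sub_eq_zero.1 (this i)

theorem diagMap_injective {b : Fin n → W} (hb : LinearIndependent ℝ b) :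
    Function.Injective (diagMap b) := fun v w h => eq_of_sum_smul_eq hb (by
  have := LinearMap.congr_fun h (fun _ => 1)
  simpa [diagMap_apply] using this)

theorem finrank_map_diag_le (b : Fin n → W) {k : ℕ} (v : Fin k → Fin n → ℝ) :
    Module.finrank ℝ ((LinearMap.range (diagMap b)).map (evalAt v)) ≤ n := by
  rw [← LinearMap.range_comp]
  simpa using LinearMap.finrank_range_le ((evalAt v).comp (diagMap b))

theorem characterSum_diag_zero (b : Fin n → W) :
    characterSum (LinearMap.range (diagMap b)) 0 = 0 := by
  have h : ∀ v : Fin 0 → Fin n → ℝ,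
      Module.finrank ℝ ((LinearMap.range (diagMap b)).map (evalAt v)) = 0 := fun v =>
    Module.finrank_zero_of_subsingleton
  simp [characterSum, h]

/-- The all-ones vector has no zero coordinate, so evaluation at it is already injective on the
tableau. One vector attains the upper bound and further vectors add nothing. -/
theorem characterSum_diag_pos {b : Fin n → W} (hb : LinearIndependent ℝ b) {k : ℕ} (hk : 1 ≤ k) :
    characterSum (LinearMap.range (diagMap b)) k = n := by
  -- An unbounded supremum in ℕ is 0 by default, so boundedness is needed for the lower estimate.
  have hbdd : BddAbove (range fun v : Fin k → Fin n → ℝ =>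
      Module.finrank ℝ ((LinearMap.range (diagMap b)).map (evalAt v))) :=
    ⟨n, by rintro _ ⟨v, rfl⟩; exact finrank_map_diag_le b v⟩
  refine le_antisymm (ciSup_le fun v => finrank_map_diag_le b v) ?_
  refine le_trans (le_of_eq ?_) (le_ciSup hbdd (fun _ _ => 1))
  rw [← LinearMap.range_comp, LinearMap.finrank_range_of_inj]
  · simp
  · intro v w h
    refine eq_of_sum_smul_eq hb ?_
    have := congrFun h ⟨0, hk⟩
    simpa [evalAt, diagMap_apply] using this

theorem character_diag_one {b : Fin n → W} (hb : LinearIndependent ℝ b) :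
    character (LinearMap.range (diagMap b)) 1 = n := by
  simp [character, characterSum_diag_pos hb le_rfl, characterSum_diag_zero]

theorem character_diag_of_two_le {b : Fin n → W} (hb : LinearIndependent ℝ b) {k : ℕ}
    (hk : 2 ≤ k) : character (LinearMap.range (diagMap b)) k = 0 := by
  rw [character, characterSum_diag_pos hb (by omega), characterSum_diag_pos hb (by omega),
    Nat.sub_self]

/-- The symmetric bilinear map `∑ l_i v_i w_i b_i`, as a function of `l`. -/
def diagMap₂ (b : Fin n → W) :
    (Fin n → ℝ) →ₗ[ℝ] (Fin n → ℝ) →ₗ[ℝ] (Fin n → ℝ) →ₗ[ℝ] W where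
  toFun l := (diagMap b).comp (LinearMap.mulLeft ℝ l)
  map_add' l l' := LinearMap.ext fun v => by simp [add_mul]
  map_smul' r l := LinearMap.ext fun v => by simp

theorem diagMap₂_apply (b : Fin n → W) (l v : Fin n → ℝ) :
    diagMap₂ b l v = diagMap b (l * v) := rfl

/-- If P(e_i) is diagonal with entries c_i, symmetry reads c_i(j) b_j = c_j(i) b_i. Independence of
the b's kills both sides for i ≠ j, leaving the n parameters c_i(i). -/
theorem prolongation_diag {b : Fin n → W} (hb : LinearIndependent ℝ b) :
    prolongation (LinearMap.range (diagMap b)) = LinearMap.range (diagMap₂ b) := by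
  apply le_antisymm
  · rintro P ⟨hP, hs⟩
    choose c hc using fun i : Fin n => hP (Pi.single i 1)
    have hne : ∀ i j, i ≠ j → c i j = 0 := by
      intro i j hij
      have h := hs (Pi.single i 1) (Pi.single j 1)
      rw [← hc i, ← hc j, diagMap_single_right, diagMap_single_right] at h
      have h2 : ∑ k, (Pi.single j (c i j) : Fin n → ℝ) k • b k =
          ∑ k, (Pi.single i (c j i) : Fin n → ℝ) k • b k := by
        rw [Finset.sum_eq_single j, Finset.sum_eq_single i] <;> simp +contextual [h]
      have h3 := congrFun (eq_of_sum_smul_eq hb h2) j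
      simpa [Pi.single_apply, hij.symm] using h3
    refine ⟨fun i => c i i, ?_⟩
    refine (Pi.basisFun ℝ (Fin n)).ext fun i => ?_
    rw [Pi.basisFun_apply, ← hc i, diagMap₂_apply]
    congr 1
    funext j
    by_cases hij : i = j
    · subst hij; simp
    · simp [hne i j hij, Ne.symm hij]
  · rintro _ ⟨l, rfl⟩
    refine ⟨fun v => ⟨_, rfl⟩, fun v w => ?_⟩
    simp only [diagMap₂_apply, diagMap_apply, Pi.mul_apply]
    exact Finset.sum_congr rfl fun i _ => by congr 1; ring

theorem finrank_prolongation_diag {b : Fin n → W} (hb : LinearIndependent ℝ b) :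
    Module.finrank ℝ (prolongation (LinearMap.range (diagMap b))) = n := by
  rw [prolongation_diag hb, LinearMap.finrank_range_of_inj]
  · simp
  · intro l l' h
    have := diagMap_injective hb (LinearMap.congr_fun h 1)
    simpa using this

/-- Both sides equal n, since only the term 1 · s_1 of the sum survives. -/
theorem cartanTest_diag (hn : 1 ≤ n) {b : Fin n → W} (hb : LinearIndependent ℝ b) :
    CartanTest (LinearMap.range (diagMap b)) := by
  rw [CartanTest, finrank_prolongation_diag hb, Finset.sum_eq_single 1]
  · rw [character_diag_one hb, one_mul]
  · intro k hk h1
    rw [character_diag_of_two_le hb (by have := (Finset.mem_Icc.1 hk).1; omega), mul_zero]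
  · intro h
    exact absurd (Finset.mem_Icc.2 ⟨le_rfl, hn⟩) h

end DiagonalTableaux

/-! ### Brackets of vector fields annihilated by contact forms -/

section ContactCalculus

variable {E : Type*} [NormedAddCommGroup E] [NormedSpace ℝ E]
  {M : Type*} [TopologicalSpace M] [ChartedSpace E M]

theorem differentiableAt_chart {f : M → ℝ} {q : M}
    (hf : MDifferentiableAt 𝓘(ℝ, E) 𝓘(ℝ, ℝ) f q) :
    DifferentiableAt ℝ (f ∘ (extChartAt 𝓘(ℝ, E) q).symm) (extChartAt 𝓘(ℝ, E) q q) := by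
  have h := hf.differentiableWithinAt_writtenInExtChartAt
  rw [modelWithCornersSelf_coe, range_id, differentiableWithinAt_univ] at h
  simpa only [writtenInExtChartAt, extChartAt_model_space_eq_id, PartialEquiv.refl_coe,
    Function.id_comp] using h

theorem dform_congr {f g : M → ℝ} {q : M} (h : f =ᶠ[𝓝 q] g) :
    dform (E := E) f q = dform g q := by
  refine LinearMap.ext fun v => ?_
  exact congrArg (fun L : E →L[ℝ] ℝ => L v) (h.mfderiv_eq (I := 𝓘(ℝ, E)) (I' := 𝓘(ℝ, ℝ)))

theorem dform_const (c : ℝ) (q : M) : dform (E := E) (fun _ : M => c) q = 0 := by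
  refine LinearMap.ext fun v => ?_
  exact congrArg (fun L : E →L[ℝ] ℝ => L v)
    (mfderiv_const (I := 𝓘(ℝ, E)) (I' := 𝓘(ℝ, ℝ)) (x := q) (c := c))

theorem dform_sum_mul {ι : Type*} [Fintype ι] {a g : ι → M → ℝ} {q : M}
    (ha : ∀ i, MDifferentiableAt 𝓘(ℝ, E) 𝓘(ℝ, ℝ) (a i) q)
    (hg : ∀ i, MDifferentiableAt 𝓘(ℝ, E) 𝓘(ℝ, ℝ) (g i) q)
    (h : MDifferentiableAt 𝓘(ℝ, E) 𝓘(ℝ, ℝ) (fun q' => ∑ i, a i q' * g i q') q)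
    (v : TangentSpace 𝓘(ℝ, E) q) :
    dform (fun q' => ∑ i, a i q' * g i q') q v =
      ∑ i, (a i q * dform (g i) q v + g i q * dform (a i) q v) := by
  rw [dform_eq_fderiv_chart h]
  have h1 : ((fun q' => ∑ i, a i q' * g i q') ∘ (extChartAt 𝓘(ℝ, E) q).symm) =
      fun y => ∑ i, (a i ∘ (extChartAt 𝓘(ℝ, E) q).symm) y *
        (g i ∘ (extChartAt 𝓘(ℝ, E) q).symm) y := rfl
  have h2 : HasFDerivAt (fun y => ∑ i, (a i ∘ (extChartAt 𝓘(ℝ, E) q).symm) y *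
        (g i ∘ (extChartAt 𝓘(ℝ, E) q).symm) y) _ (extChartAt 𝓘(ℝ, E) q q) :=
    HasFDerivAt.fun_sum fun i _ =>
      (differentiableAt_chart (ha i)).hasFDerivAt.mul (differentiableAt_chart (hg i)).hasFDerivAt
  rw [h1, h2.fderiv]
  have h3 : ∀ i, dform (E := E) (g i) q v = _ := fun i => dform_eq_fderiv_chart (hg i) v
  have h4 : ∀ i, dform (E := E) (a i) q v = _ := fun i => dform_eq_fderiv_chart (ha i) v
  simp only [h3, h4]
  refine (sum_apply _ _ _).trans (Finset.sum_congr rfl fun i _ => ?_)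
  simp only [Function.comp_apply, extChartAt_to_inv]
  rfl

theorem contMDiffOn_sum_mul {ι : Type*} [Fintype ι] {a g : ι → M → ℝ} {V : Set M}
    (ha : ∀ i, ContMDiffOn 𝓘(ℝ, E) 𝓘(ℝ, ℝ) ∞ (a i) V)
    (hg : ∀ i, ContMDiffOn 𝓘(ℝ, E) 𝓘(ℝ, ℝ) ∞ (g i) V) :
    ContMDiffOn 𝓘(ℝ, E) 𝓘(ℝ, ℝ) ∞ (fun q' => ∑ i, a i q' * g i q') V :=
  contMDiffOn_finsetSum fun i _ => (ha i).mul (hg i)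

variable [IsManifold 𝓘(ℝ, E) ∞ M] [CompleteSpace E]

/-- If `df = ∑ a_j dx_j` on `Y` and on `Z`, then
`df [Y, Z] = ∑ a_j dx_j [Y, Z] + ∑ (da_j ∧ dx_j)(Y, Z)`. -/
theorem der_bracket_of_contact {ι : Type*} [Fintype ι] {Y Z : VField E M} {f : M → ℝ}
    {a x : ι → M → ℝ} {V : Set M} (hV : IsOpen V) (hY : SmoothOn Y V) (hZ : SmoothOn Z V)
    (hf : ContMDiffOn 𝓘(ℝ, E) 𝓘(ℝ, ℝ) ∞ f V)
    (ha : ∀ j, ContMDiffOn 𝓘(ℝ, E) 𝓘(ℝ, ℝ) ∞ (a j) V)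
    (hx : ∀ j, ContMDiffOn 𝓘(ℝ, E) 𝓘(ℝ, ℝ) ∞ (x j) V)
    (hYf : ∀ q ∈ V, dform f q (Y q) = ∑ j, a j q * dform (x j) q (Y q))
    (hZf : ∀ q ∈ V, dform f q (Z q) = ∑ j, a j q * dform (x j) q (Z q)) {q : M} (hq : q ∈ V) :
    dform f q (bracket Y Z q) = ∑ j, a j q * dform (x j) q (bracket Y Z q) +
      ∑ j, (dform (a j) q (Y q) * dform (x j) q (Z q) -
        dform (a j) q (Z q) * dform (x j) q (Y q)) := by
  -- Differentiate Zf = ∑ a_j Zx_j along Y. The fields are bound again so that the formula also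
  -- applies with Y and Z exchanged; in the difference the second derivatives of x_j combine to dx_j
  -- [Y, Z].
  have key : ∀ Y Z : VField E M, SmoothOn Y V → SmoothOn Z V →
      (∀ q ∈ V, dform f q (Z q) = ∑ j, a j q * dform (x j) q (Z q)) →
      der Y (der Z f) q =
        ∑ j, (a j q * der Y (der (Z) (x j)) q + dform (x j) q (Z q) * dform (a j) q (Y q)) := by
    intro Y Z hY hZ h
    have e : der Z f =ᶠ[𝓝 q] fun q' => ∑ j, a j q' * der Z (x j) q' := by
      filter_upwards [hV.mem_nhds hq] with q' hq' using h q' hq'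
    have hs := fun j => contMDiffOn_der hV hZ (hx j)
    rw [der, dform_congr e, dform_sum_mul (fun j => mdifferentiableAt_of_smooth hV (ha j) hq)
      (fun j => mdifferentiableAt_of_smooth hV (hs j) hq)
      (mdifferentiableAt_of_smooth hV (contMDiffOn_sum_mul ha hs) hq)]
    rfl
  have h1 := der_bracket hV hY hZ hf hq
  have h2 := fun j => der_bracket hV hY hZ (hx j) hq
  rw [key Y Z hY hZ hZf, key Z Y hZ hY hYf] at h1
  simp only [der] at h2
  refine h1.trans ?_
  simp only [h2]
  rw [← Finset.sum_sub_distrib, ← Finset.sum_add_distrib]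
  refine Finset.sum_congr rfl fun j _ => ?_
  simp only [der]
  ring

/-- `df [Y, Z] = Y (Z f)` when `Y f` is constant. -/
theorem dform_bracket_of_left_const {Y Z : VField E M} {f : M → ℝ} {V : Set M} (hV : IsOpen V)
    (hY : SmoothOn Y V) (hZ : SmoothOn Z V) (hf : ContMDiffOn 𝓘(ℝ, E) 𝓘(ℝ, ℝ) ∞ f V) {c : ℝ}
    (hYf : ∀ q ∈ V, dform f q (Y q) = c) {q : M} (hq : q ∈ V) :
    dform f q (bracket Y Z q) = dform (der Z f) q (Y q) := by
  have h := der_bracket hV hY hZ hf hq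
  have e : der Y f =ᶠ[𝓝 q] fun _ => c := by
    filter_upwards [hV.mem_nhds hq] with q' hq' using hYf q' hq'
  have h0 : der Z (der Y f) q = 0 := by
    rw [der, dform_congr e, dform_const]; rfl
  rw [h0, sub_zero] at h
  exact h

/-- `df [Y, Z] = 0` when `Y f` and `Z f` are constant. -/
theorem dform_bracket_of_const {Y Z : VField E M} {f : M → ℝ} {V : Set M} (hV : IsOpen V)
    (hY : SmoothOn Y V) (hZ : SmoothOn Z V) (hf : ContMDiffOn 𝓘(ℝ, E) 𝓘(ℝ, ℝ) ∞ f V) {c c' : ℝ}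
    (hYf : ∀ q ∈ V, dform f q (Y q) = c) (hZf : ∀ q ∈ V, dform f q (Z q) = c')
    {q : M} (hq : q ∈ V) : dform f q (bracket Y Z q) = 0 := by
  have e : der Z f =ᶠ[𝓝 q] fun _ => c' := by
    filter_upwards [hV.mem_nhds hq] with q' hq' using hZf q' hq'
  rw [dform_bracket_of_left_const hV hY hZ hf hYf hq, dform_congr e, dform_const]
  rfl

end ContactCalculus

/-! ### Abstract jet systems: bracket formula, tableau and involutivity -/

section JetSystems

variable {E : Type*} [NormedAddCommGroup E] [NormedSpace ℝ E]
  {M : Type*} [TopologicalSpace M] [ChartedSpace E M] {n : ℕ}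

/-- The form `π_i = (du_{ii} - ∑ (T_j u_{ii}) dx_j) / a_i`. -/
noncomputable def jetPi (x : Fin n → M → ℝ) (u₂ : Sym2 (Fin n) → M → ℝ) (q : M)
    (T : Fin n → VField E M)
    (a : Fin n → ℝ) (i : Fin n) : Module.Dual ℝ (TangentSpace 𝓘(ℝ, E) q) :=
  (a i)⁻¹ • (dform (u₂ s(i, i)) q -
    ∑ j, dform (u₂ s(i, i)) q (T j q) • dform (x j) q)

theorem jetPi_apply (x : Fin n → M → ℝ) (u₂ : Sym2 (Fin n) → M → ℝ) (q : M)
    (T : Fin n → VField E M) (a : Fin n → ℝ) (i : Fin n) (v : TangentSpace 𝓘(ℝ, E) q) :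
    jetPi x u₂ q T a i v = (a i)⁻¹ * (dform (u₂ s(i, i)) q v -
      ∑ j, dform (u₂ s(i, i)) q (T j q) * dform (x j) q v) := by
  simp only [jetPi, LinearMap.smul_apply, LinearMap.sub_apply, smul_eq_mul]
  rw [LinearMap.sum_apply]
  rfl

/-- Over `U`, the forms `du - ∑ u_i dx_i` and `du_i - ∑ u_{ij} dx_j` vanish on the
distribution `D`. -/
structure IsJetSubsystem (D : Distribution E M) (U : Set M) (x : Fin n → M → ℝ) (u : M → ℝ)
    (u₁ : Fin n → M → ℝ) (u₂ : Sym2 (Fin n) → M → ℝ) : Prop where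
  isOpen : IsOpen U
  smooth_x : ∀ i, ContMDiffOn 𝓘(ℝ, E) 𝓘(ℝ, ℝ) ∞ (x i) U
  smooth_u : ContMDiffOn 𝓘(ℝ, E) 𝓘(ℝ, ℝ) ∞ u U
  smooth_u₁ : ∀ i, ContMDiffOn 𝓘(ℝ, E) 𝓘(ℝ, ℝ) ∞ (u₁ i) U
  smooth_u₂ : ∀ s, ContMDiffOn 𝓘(ℝ, E) 𝓘(ℝ, ℝ) ∞ (u₂ s) U
  contact_of_mem : ∀ q ∈ U, ∀ v ∈ D q,
    dform u q v = ∑ i, u₁ i q * dform (x i) q v ∧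
      ∀ i, dform (u₁ i) q v = ∑ j, u₂ s(i, j) q * dform (x j) q v

/-- Over `U`, the distribution `D` is the common kernel of `du - ∑ u_i dx_i` and
`du_i - ∑ u_{ij} dx_j`. -/
structure IsJetSystem (D : Distribution E M) (U : Set M) (x : Fin n → M → ℝ) (u : M → ℝ)
    (u₁ : Fin n → M → ℝ) (u₂ : Sym2 (Fin n) → M → ℝ) : Prop
    extends IsJetSubsystem D U x u u₁ u₂ where
  mem_of_contact : ∀ q ∈ U, ∀ v, dform u q v = ∑ i, u₁ i q * dform (x i) q v →
    (∀ i, dform (u₁ i) q v = ∑ j, u₂ s(i, j) q * dform (x j) q v) → v ∈ D q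

variable {D : Distribution E M} {U : Set M} {x : Fin n → M → ℝ} {u : M → ℝ}
  {u₁ : Fin n → M → ℝ} {u₂ : Sym2 (Fin n) → M → ℝ} {q : M}

theorem IsJetSystem.mem_iff (h : IsJetSystem D U x u u₁ u₂) (hq : q ∈ U)
    (v : TangentSpace 𝓘(ℝ, E) q) : v ∈ D q ↔
      dform u q v = ∑ i, u₁ i q * dform (x i) q v ∧
        ∀ i, dform (u₁ i) q v = ∑ j, u₂ s(i, j) q * dform (x j) q v :=
  ⟨h.contact_of_mem q hq v, fun hv => h.mem_of_contact q hq v hv.1 hv.2⟩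

variable [IsManifold 𝓘(ℝ, E) ∞ M]

/-- A frame `T_i, V_i` of `D` near `q` with `dx_i (T_j) = δ_{ij}` and `dx_i (V_j) = 0`, such that
`T_k u_{ij}` is symmetric and `V_k u_{ij} = 0` at `q`, apart from `V_i u_{ii} = a_i ≠ 0`; the
vectors `B_i` are dual to the `du_i` up to the factors `a_i`. -/
structure IsJetFrameAt (D : Distribution E M) (x : Fin n → M → ℝ) (u : M → ℝ)
    (u₁ : Fin n → M → ℝ) (u₂ : Sym2 (Fin n) → M → ℝ) (q : M) (T V : Fin n → VField E M)
    (B : Fin n → TangentSpace 𝓘(ℝ, E) q) (a : Fin n → ℝ) : Prop where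
  section_T : ∀ i, IsLocalSection D q (T i)
  section_V : ∀ i, IsLocalSection D q (V i)
  dx_T : ∀ i j, dform (x j) q (T i q) = if i = j then 1 else 0
  dx_V : ∀ i j, dform (x j) q (V i q) = 0
  mem_span_V : ∀ v ∈ D q, (∀ i, dform (x i) q v = 0) →
    v ∈ Submodule.span ℝ (range fun i => V i q)
  du₂_T : ∀ i j k, dform (u₂ s(i, j)) q (T k q) = dform (u₂ s(i, k)) q (T j q)
  du₂_V : ∀ s k, dform (u₂ s) q (V k q) = if s = s(k, k) then a k else 0
  a_ne : ∀ i, a i ≠ 0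
  dx_B : ∀ i j, dform (x j) q (B i) = 0
  du_B : ∀ i, dform u q (B i) = 0
  du₁_B : ∀ i j, dform (u₁ j) q (B i) = if i = j then a i else 0

variable {T V : Fin n → VField E M} {B : Fin n → TangentSpace 𝓘(ℝ, E) q} {a : Fin n → ℝ}

theorem IsLocalSection.mem {Y : VField E M} (hY : IsLocalSection D q Y) : Y q ∈ D q := by
  obtain ⟨V, -, hq, h⟩ := hY
  exact h.2 q hq

/-- The correction term ∑ du_i ∧ dx_i becomes ∑ u_ij dx_j ∧ dx_i on D, which vanishes because u_ij
is symmetric. -/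
theorem IsJetSubsystem.dform_u_bracket [CompleteSpace E] (h : IsJetSubsystem D U x u u₁ u₂)
    (hq : q ∈ U) {Y Z : VField E M} (hY : IsLocalSection D q Y) (hZ : IsLocalSection D q Z) :
    dform u q (bracket Y Z q) = ∑ i, u₁ i q * dform (x i) q (bracket Y Z q) := by
  have hmY := (h.contact_of_mem q hq _ hY.mem).2
  have hmZ := (h.contact_of_mem q hq _ hZ.mem).2
  obtain ⟨V₁, ho₁, hq₁, hs₁, hm₁⟩ := hY
  obtain ⟨V₂, ho₂, hq₂, hs₂, hm₂⟩ := hZ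
  rw [der_bracket_of_contact (V := U ∩ (V₁ ∩ V₂)) (a := u₁) (x := x)
    (h.isOpen.inter (ho₁.inter ho₂)) (hs₁.mono fun _ h => h.2.1) (hs₂.mono fun _ h => h.2.2)
    (h.smooth_u.mono inter_subset_left) (fun i => (h.smooth_u₁ i).mono inter_subset_left)
    (fun i => (h.smooth_x i).mono inter_subset_left)
    (fun q' hq' => (h.contact_of_mem q' hq'.1 _ (hm₁ q' hq'.2.1)).1)
    (fun q' hq' => (h.contact_of_mem q' hq'.1 _ (hm₂ q' hq'.2.2)).1) ⟨hq, hq₁, hq₂⟩]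
  have h0 : ∑ j, (dform (u₁ j) q (Y q) * dform (x j) q (Z q) -
        dform (u₁ j) q (Z q) * dform (x j) q (Y q)) = 0 := by
    simp only [hmY, hmZ]
    simp only [Finset.sum_mul, Finset.sum_sub_distrib]
    rw [sub_eq_zero, Finset.sum_comm]
    refine Finset.sum_congr rfl fun i _ => Finset.sum_congr rfl fun j _ => ?_
    rw [Sym2.eq_swap]
    ring
  rw [h0, add_zero]

/-- At this order the correction ∑ du_ij ∧ dx_j is kept: nothing in a subsystem expresses du_ij
through the dx_k. A frame is used below to evaluate it. -/
theorem IsJetSubsystem.dform_u₁_bracket [CompleteSpace E] (h : IsJetSubsystem D U x u u₁ u₂)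
    (hq : q ∈ U) {Y Z : VField E M} (hY : IsLocalSection D q Y) (hZ : IsLocalSection D q Z)
    (i : Fin n) :
    dform (u₁ i) q (bracket Y Z q) = ∑ j, u₂ s(i, j) q * dform (x j) q (bracket Y Z q) +
      ∑ j, (dform (u₂ s(i, j)) q (Y q) * dform (x j) q (Z q) -
        dform (u₂ s(i, j)) q (Z q) * dform (x j) q (Y q)) := by
  obtain ⟨V₁, ho₁, hq₁, hs₁, hm₁⟩ := hY
  obtain ⟨V₂, ho₂, hq₂, hs₂, hm₂⟩ := hZ
  exact der_bracket_of_contact (V := U ∩ (V₁ ∩ V₂)) (a := fun j => u₂ s(i, j)) (x := x)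
    (h.isOpen.inter (ho₁.inter ho₂)) (hs₁.mono fun _ h => h.2.1) (hs₂.mono fun _ h => h.2.2)
    ((h.smooth_u₁ i).mono inter_subset_left)
    (fun j => (h.smooth_u₂ s(i, j)).mono inter_subset_left)
    (fun i => (h.smooth_x i).mono inter_subset_left)
    (fun q' hq' => (h.contact_of_mem q' hq'.1 _ (hm₁ q' hq'.2.1)).2 i)
    (fun q' hq' => (h.contact_of_mem q' hq'.1 _ (hm₂ q' hq'.2.2)).2 i) ⟨hq, hq₁, hq₂⟩

namespace IsJetFrameAt

theorem jetPi_V (hF : IsJetFrameAt D x u u₁ u₂ q T V B a)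
    (i k : Fin n) : jetPi x u₂ q T a i (V k q) = if i = k then 1 else 0 := by
  rw [jetPi_apply, hF.du₂_V]
  simp only [hF.dx_V, mul_zero, Finset.sum_const_zero, sub_zero]
  by_cases h : i = k
  · subst h; simp [hF.a_ne]
  · simp [h]

theorem jetPi_T (hF : IsJetFrameAt D x u u₁ u₂ q T V B a)
    (i k : Fin n) : jetPi x u₂ q T a i (T k q) = 0 := by
  rw [jetPi_apply]
  simp [hF.dx_T]

/-- Removing the T-components leaves a vector of D killed by all dx_i, hence a combination of the
V_k. Its coefficients are read off by the π_k, which are dual to the V_k and vanish on the T_k. -/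
theorem eq_sum (hF : IsJetFrameAt D x u u₁ u₂ q T V B a)
    {v : TangentSpace 𝓘(ℝ, E) q} (hv : v ∈ D q) :
    v = ∑ k, dform (x k) q v • T k q + ∑ k, jetPi x u₂ q T a k v • V k q := by
  set w := v - ∑ k, dform (x k) q v • T k q with hw
  have hwD : w ∈ D q := (D q).sub_mem hv
    ((D q).sum_mem fun k _ => (D q).smul_mem _ (hF.section_T k).mem)
  have hwx : ∀ i, dform (x i) q w = 0 := by
    intro i
    rw [hw, map_sub, map_sum]
    simp [hF.dx_T]
  obtain ⟨c, hc⟩ := (Submodule.mem_span_range_iff_exists_fun ℝ).1 (hF.mem_span_V w hwD hwx)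
  have hcπ : ∀ k, jetPi x u₂ q T a k v = c k := by
    intro k
    have hv' : v = ∑ k, dform (x k) q v • T k q + ∑ k, c k • V k q := by
      rw [hc, hw]; abel
    rw [hv', map_add, map_sum, map_sum]
    simp [hF.jetPi_T, hF.jetPi_V]
  simp only [hcπ, hc, hw]
  abel

theorem dform_u₂ (hF : IsJetFrameAt D x u u₁ u₂ q T V B a)
    {v : TangentSpace 𝓘(ℝ, E) q} (hv : v ∈ D q) (i j : Fin n) :
    dform (u₂ s(i, j)) q v = ∑ k, dform (x k) q v * dform (u₂ s(i, j)) q (T k q) +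
      if i = j then jetPi x u₂ q T a i v * a i else 0 := by
  conv_lhs => rw [hF.eq_sum hv]
  rw [map_add, map_sum, map_sum]
  simp only [map_smul, smul_eq_mul, hF.du₂_V]
  congr 1
  by_cases h : i = j
  · subst h
    rw [Finset.sum_eq_single i]
    · simp
    · intro k _ hk
      simp [Ne.symm hk]
    · simp
  · rw [if_neg h]
    refine Finset.sum_eq_zero fun k _ => ?_
    rw [if_neg, mul_zero]
    simp only [Sym2.eq_iff, or_self, not_and]
    rintro rfl rfl
    exact h rfl

/-- On D, each du_ij is a combination of the dx_k, plus a_i π_i when i = j. The dx ∧ dx part of the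
correction cancels because T_k u_ij is symmetric in j and k; this is the vanishing of the torsion.
-/
theorem dform_u₁_bracket [CompleteSpace E] (hF : IsJetFrameAt D x u u₁ u₂ q T V B a)
    (h : IsJetSystem D U x u u₁ u₂) (hq : q ∈ U)
    {Y Z : VField E M} (hY : IsLocalSection D q Y)
    (hZ : IsLocalSection D q Z) (i : Fin n) :
    dform (u₁ i) q (bracket Y Z q) = ∑ j, u₂ s(i, j) q * dform (x j) q (bracket Y Z q) +
      a i * (jetPi x u₂ q T a i (Y q) * dform (x i) q (Z q) -
        jetPi x u₂ q T a i (Z q) * dform (x i) q (Y q)) := by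
  rw [h.dform_u₁_bracket hq hY hZ i]
  congr 1
  simp only [hF.dform_u₂ hY.mem, hF.dform_u₂ hZ.mem, add_mul, Finset.sum_mul, ite_mul, zero_mul]
  have h0 : ∑ j, ∑ k, dform (x k) q (Y q) * dform (u₂ s(i, j)) q (T k q) * dform (x j) q (Z q) =
      ∑ j, ∑ k, dform (x k) q (Z q) * dform (u₂ s(i, j)) q (T k q) * dform (x j) q (Y q) := by
    rw [Finset.sum_comm]
    refine Finset.sum_congr rfl fun k _ => Finset.sum_congr rfl fun j _ => ?_
    rw [hF.du₂_T i j k]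
    ring
  rw [Finset.sum_sub_distrib, Finset.sum_add_distrib, Finset.sum_add_distrib, h0]
  simp only [Finset.sum_ite_eq, Finset.mem_univ, if_true]
  ring

/-- The contact forms detect vectors modulo D, so it suffices to compare their values on both sides.
The factor a_i in du_i(B_i) matches the one in the bracket formula, and du - ∑ u_i dx_i vanishes on
both sides. -/
theorem mkQ_bracket [CompleteSpace E] (hF : IsJetFrameAt D x u u₁ u₂ q T V B a)
    (h : IsJetSystem D U x u u₁ u₂) (hq : q ∈ U)
    {Y Z : VField E M} (hY : IsLocalSection D q Y) (hZ : IsLocalSection D q Z) :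
    (D q).mkQ (bracket Y Z q) = ∑ i, (jetPi x u₂ q T a i (Y q) * dform (x i) q (Z q) -
        jetPi x u₂ q T a i (Z q) * dform (x i) q (Y q)) • (D q).mkQ (B i) := by
  simp only [← map_smul]
  rw [← map_sum, ← sub_eq_zero, ← map_sub, Submodule.mkQ_apply, Submodule.Quotient.mk_eq_zero,
    h.mem_iff hq]
  constructor
  · rw [map_sub, map_sum, h.dform_u_bracket hq hY hZ]
    simp [hF.du_B, hF.dx_B]
  · intro i
    rw [map_sub, map_sum, hF.dform_u₁_bracket h hq hY hZ i]
    simp [hF.du₁_B, hF.dx_B]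
    ring

theorem linearIndependent_mkQ (hF : IsJetFrameAt D x u u₁ u₂ q T V B a)
    (h : IsJetSystem D U x u u₁ u₂) (hq : q ∈ U) :
    LinearIndependent ℝ fun i => (D q).mkQ (B i) := by
  refine Fintype.linearIndependent_iff.2 fun c hc j => ?_
  simp only [← map_smul] at hc
  rw [← map_sum, Submodule.mkQ_apply, Submodule.Quotient.mk_eq_zero, h.mem_iff hq] at hc
  have := hc.2 j
  rw [map_sum] at this
  simpa [hF.du₁_B, hF.dx_B, hF.a_ne] using this

/-- Bracketing Y with T_j, where dx(T_j) is the j-th unit vector, gives π_j(Y) B_j modulo D: a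
diagonal map with entries π(Y). Conversely V_i realises the i-th diagonal unit. -/
theorem tableau_eq [CompleteSpace E] (hF : IsJetFrameAt D x u u₁ u₂ q T V B a)
    (h : IsJetSystem D U x u u₁ u₂) (hq : q ∈ U) : tableau D (fun i => dform (x i)) q =
    LinearMap.range (diagMap fun i => (D q).mkQ (B i)) := by
  apply le_antisymm
  · refine Submodule.span_le.2 ?_
    rintro b ⟨Y, hY, hY0, hb⟩
    refine ⟨fun i => jetPi x u₂ q T a i (Y q), ?_⟩
    refine (Pi.basisFun ℝ (Fin n)).ext fun j => ?_
    have hj : (fun i => dform (x i) q (T j q)) = Pi.single j 1 := by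
      funext i
      rw [hF.dx_T, Pi.single_apply]
      exact if_congr eq_comm rfl rfl
    rw [Pi.basisFun_apply, diagMap_single_right, ← hj, hb _ (hF.section_T j),
      hF.mkQ_bracket h hq hY (hF.section_T j)]
    rw [Finset.sum_eq_single j] <;> simp +contextual [hF.dx_T, hY0, eq_comm]
  · rintro _ ⟨v, rfl⟩
    rw [LinearMap.pi_apply_eq_sum_univ (diagMap _) v]
    refine Submodule.sum_mem _ fun i _ => Submodule.smul_mem _ _ (Submodule.subset_span ?_)
    refine ⟨V i, hF.section_V i, fun j => hF.dx_V i j, fun Z hZ => ?_⟩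
    rw [hF.mkQ_bracket h hq (hF.section_V i) hZ, diagMap_apply]
    refine Finset.sum_congr rfl fun j _ => ?_
    rw [hF.jetPi_V, hF.dx_V, mul_zero, sub_zero]
    by_cases hij : i = j <;> simp [hij, eq_comm]

/-- Each term π_i ∧ dx_i of the bracket formula vanishes on two fields killed by the dx_i, which
gives linearity. It also vanishes on T_i, T_j because π kills them, so the T_i span an integral
element. -/
theorem isInvolutiveAt [CompleteSpace E] (hF : IsJetFrameAt D x u u₁ u₂ q T V B a)
    (h : IsJetSystem D U x u u₁ u₂) (hq : q ∈ U)
    (hn : 1 ≤ n) : IsInvolutiveAt D (fun i => dform (x i)) q := by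
  refine ⟨⟨fun c => ⟨∑ k, c k • T k q, (D q).sum_mem fun k _ => (D q).smul_mem _
      (hF.section_T k).mem, fun i => ?_⟩, fun Y Z hY hZ hY0 hZ0 => ?_⟩,
    ⟨T, hF.section_T, hF.dx_T, fun i j => ?_⟩, ?_⟩
  · rw [map_sum]
    simp [hF.dx_T]
  · rw [← Submodule.Quotient.mk_eq_zero, ← Submodule.mkQ_apply, hF.mkQ_bracket h hq hY hZ]
    simp [hY0, hZ0]
  · rw [← Submodule.Quotient.mk_eq_zero, ← Submodule.mkQ_apply,
      hF.mkQ_bracket h hq (hF.section_T i) (hF.section_T j)]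
    simp [hF.jetPi_T]
  · rw [hF.tableau_eq h hq]
    exact cartanTest_diag hn (hF.linearIndependent_mkQ h hq)

theorem character_one [CompleteSpace E] (hF : IsJetFrameAt D x u u₁ u₂ q T V B a)
    (h : IsJetSystem D U x u u₁ u₂) (hq : q ∈ U) :
    character (tableau D (fun i => dform (x i)) q) 1 = n := by
  rw [hF.tableau_eq h hq]
  exact character_diag_one (hF.linearIndependent_mkQ h hq)

theorem character_of_two_le [CompleteSpace E] (hF : IsJetFrameAt D x u u₁ u₂ q T V B a)
    (h : IsJetSystem D U x u u₁ u₂) (hq : q ∈ U)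
    {k : ℕ} (hk : 2 ≤ k) :
    character (tableau D (fun i => dform (x i)) q) k = 0 := by
  rw [hF.tableau_eq h hq]
  exact character_diag_of_two_le (hF.linearIndependent_mkQ h hq) hk

end IsJetFrameAt

end JetSystems

/-! ### Adapted coordinate fields and the spanning set of 𝒜 -/

section Coordinates

variable {E : Type*} [NormedAddCommGroup E] [NormedSpace ℝ E]
  {M : Type*} [TopologicalSpace M] [ChartedSpace E M] {n : ℕ}

theorem dform_clm_comp {F : Type*} [NormedAddCommGroup F] [NormedSpace ℝ F] {f : M → F} {q : M}
    (hf : MDifferentiableAt 𝓘(ℝ, E) 𝓘(ℝ, F) f q) (L : F →L[ℝ] ℝ) (v : TangentSpace 𝓘(ℝ, E) q) :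
    dform (fun q' => L (f q')) q v = L (mfderiv 𝓘(ℝ, E) 𝓘(ℝ, F) f q v) := by
  have h := mfderiv_comp q (L.mdifferentiableAt (x := f q)) hf
  rw [L.mfderiv_eq] at h
  exact congrArg (fun A : E →L[ℝ] ℝ => A v) h

/-- The coordinate function `x_i` on `Coord n`, as a continuous linear map. -/
noncomputable def Coord.projX (i : Fin n) : Coord n →L[ℝ] ℝ :=
  (ContinuousLinearMap.proj i).comp (ContinuousLinearMap.fst ℝ _ _)

theorem mdifferentiableAt_coord (χ : CoordSystem n E M) {q : M} (hq : q ∈ χ.source) :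
    MDifferentiableAt 𝓘(ℝ, E) 𝓘(ℝ, Coord n) χ q :=
  χ.mdifferentiableAt (by simp) hq

theorem contMDiffOn_xfun (χ : CoordSystem n E M) (i : Fin n) :
    ContMDiffOn 𝓘(ℝ, E) 𝓘(ℝ, ℝ) ∞ (xfun χ i) χ.source :=
  (Coord.projX i).contMDiff.comp_contMDiffOn χ.contMDiffOn

theorem isInvertible_mfderiv_coord (χ : CoordSystem n E M) {q : M} (hq : q ∈ χ.source) :
    (mfderiv 𝓘(ℝ, E) 𝓘(ℝ, Coord n) χ q).IsInvertible :=
  ⟨(χ.isLocalDiffeomorphAt _ _ _ hq).mfderivToContinuousLinearEquiv (by simp), rfl⟩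

theorem mfderiv_coordField (χ : CoordSystem n E M) {q : M} (hq : q ∈ χ.source) (c : Coord n) :
    mfderiv 𝓘(ℝ, E) 𝓘(ℝ, Coord n) χ q (coordField χ c q) = c := by
  obtain ⟨L, hL⟩ := isInvertible_mfderiv_coord χ hq
  have h1 : coordField χ c q = L.symm c := by
    change (mfderiv 𝓘(ℝ, E) 𝓘(ℝ, Coord n) χ q).inverse c = L.symm c
    rw [← hL, ContinuousLinearMap.inverse_equiv]
    rfl
  rw [h1, ← hL]
  exact L.apply_symm_apply c

theorem dform_xfun_coordField (χ : CoordSystem n E M) {q : M} (hq : q ∈ χ.source) (c : Coord n)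
    (i : Fin n) : dform (xfun χ i) q (coordField χ c q) = c.1 i := by
  have h := dform_clm_comp (mdifferentiableAt_coord χ hq) (Coord.projX i) (coordField χ c q)
  rw [mfderiv_coordField χ hq] at h
  exact h

theorem dx_ddu (χ : CoordSystem n E M) {q : M} (hq : q ∈ χ.source) (i j : Fin n) :
    dform (xfun χ j) q (ddu χ i q) = 0 := dform_xfun_coordField χ hq _ j

theorem calA_eq_span (χ : CoordSystem n E M) (X : Fin n → VField E M) (q : M) :
    calA χ X q = Submodule.span ℝ (range (Sum.elim (fun i => ddu χ i q)
      (fun i => bracket (ddu χ i) (X i) q))) := by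
  rw [calA, Sum.elim_range]

theorem mem_calA_iff_exists (χ : CoordSystem n E M) (X : Fin n → VField E M) {q : M}
    {v : TangentSpace 𝓘(ℝ, E) q} : v ∈ calA χ X q ↔ ∃ b c : Fin n → ℝ,
      v = ∑ k, b k • ddu χ k q + ∑ k, c k • bracket (ddu χ k) (X k) q := by
  rw [calA_eq_span, Submodule.mem_span_range_iff_exists_fun]
  constructor
  · rintro ⟨c, rfl⟩
    exact ⟨fun k => c (Sum.inl k), fun k => c (Sum.inr k), by rw [Fintype.sum_sum_type]; rfl⟩
  · rintro ⟨b, c, rfl⟩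
    exact ⟨Sum.elim b c, by rw [Fintype.sum_sum_type]; rfl⟩

theorem dform_eq_zero_of_mem_span {χ : CoordSystem n E M} {f : M → ℝ} {q : M}
    (hf : ∀ i, dform f q (ddu χ i q) = 0)
    {v : TangentSpace 𝓘(ℝ, E) q} (hv : v ∈ Submodule.span ℝ (range fun i => ddu χ i q)) :
    dform f q v = 0 := by
  obtain ⟨c, rfl⟩ := (Submodule.mem_span_range_iff_exists_fun ℝ).1 hv
  rw [map_sum]
  simp [hf]

variable [IsManifold 𝓘(ℝ, E) ∞ M]

theorem smoothOn_coordField [CompleteSpace E] (χ : CoordSystem n E M) (c : Coord n) :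
    SmoothOn (coordField χ c) χ.source := by
  intro q hq
  refine ContMDiffAt.contMDiffWithinAt ?_
  refine ContMDiffAt.mpullback_vectorField_preimage (n := ∞) ?_
    (χ.contMDiffOn.contMDiffAt (χ.open_source.mem_nhds hq)) (isInvertible_mfderiv_coord χ hq)
    (by simp)
  exact contMDiffAt_vectorSpace_iff_contDiffAt.2 contDiffAt_const

end Coordinates

/-! ### Integrability of 𝒜 and the first and second derivatives of `p` -/

section Invariants

variable {E : Type*} [NormedAddCommGroup E] [NormedSpace ℝ E]
  {M : Type*} [TopologicalSpace M] [ChartedSpace E M] [IsManifold 𝓘(ℝ, E) ∞ M] {n : ℕ}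

/-- An `n`-hyperbolic manifold with adapted coordinates and a function `p` which, together with the
`x_i`, spans the invariants of `𝒜`. -/
structure HasInvariants (Hs : Fin n → Distribution E M) (χ : CoordSystem n E M)
    (X : Fin n → VField E M) (p : M → ℝ) : Prop where
  hyperbolic : IsNHyperbolic Hs
  adapted : IsAdapted Hs χ X
  invariants : SpansInvariants χ X p

/-- The functions `X_j p_i`, indexed by unordered pairs. -/
noncomputable def pSym (X : Fin n → VField E M) (p : M → ℝ) (s : Sym2 (Fin n)) : M → ℝ :=
  p2 X p s.inf s.sup

namespace HasInvariants

variable {Hs : Fin n → Distribution E M} {χ : CoordSystem n E M} {X : Fin n → VField E M}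
  {p : M → ℝ} {q : M}

theorem dx_X (h : HasInvariants Hs χ X p) (hq : q ∈ χ.source) (i j : Fin n) :
    dform (xfun χ j) q (X i q) = if i = j then 1 else 0 := by
  obtain ⟨ρ, σ, hρ⟩ := h.adapted.form i q hq
  have h2 : ∀ a, dform (xfun χ j) q (ddy χ a q) = 0 := fun a => dform_xfun_coordField χ hq _ j
  have h3 : dform (xfun χ j) q (ddx χ i q) = if i = j then 1 else 0 := by
    refine (dform_xfun_coordField χ hq _ j).trans ?_
    simp [Pi.single_apply, eq_comm]
  rw [hρ, map_add, map_add, map_sum, map_sum]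
  simp [h2, h3, dx_ddu χ hq]

/-- In finite dimension a subspace is recovered from its annihilator, so the hypothesis on covectors
becomes a criterion for vectors. -/
theorem mem_calA (h : HasInvariants Hs χ X p) [FiniteDimensional ℝ E] (hq : q ∈ χ.source)
    (v : TangentSpace 𝓘(ℝ, E) q) :
    v ∈ calA χ X q ↔ (∀ i, dform (xfun χ i) q v = 0) ∧ dform p q v = 0 := by
  have hs := h.invariants.2 q hq
  rw [← Subspace.dualAnnihilator_dualCoannihilator_eq (W := calA χ X q), ← hs,
    Submodule.mem_dualCoannihilator]
  constructor
  · intro hv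
    exact ⟨fun i => hv _ (Submodule.subset_span (Or.inl ⟨i, rfl⟩)),
      hv _ (Submodule.subset_span (Or.inr rfl))⟩
  · rintro ⟨hx, hp⟩ φ hφ
    induction hφ using Submodule.span_induction with
    | mem φ hφ =>
      rcases hφ with ⟨i, rfl⟩ | rfl
      exacts [hx i, hp]
    | zero => rfl
    | add φ ψ _ _ h1 h2 => rw [LinearMap.add_apply, h1, h2, add_zero]
    | smul c φ _ h1 => rw [LinearMap.smul_apply, h1, smul_zero]

/-- There are 2n generators of 𝒜 and n + 1 generators of its annihilator. The two dimensions add up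
to 3n + 1, so both upper bounds are attained. -/
theorem finrank_calA (h : HasInvariants Hs χ X p) [FiniteDimensional ℝ E] (hq : q ∈ χ.source) :
    Module.finrank ℝ (calA χ X q) = 2 * n := by
  have : FiniteDimensional ℝ (TangentSpace 𝓘(ℝ, E) q) := inferInstanceAs (FiniteDimensional ℝ E)
  have hdim : Module.finrank ℝ (TangentSpace 𝓘(ℝ, E) q) = 3 * n + 1 := h.hyperbolic.dim_eq
  have h1 := Subspace.finrank_add_finrank_dualAnnihilator_eq (calA χ X q)
  have h2 : Module.finrank ℝ (calA χ X q).dualAnnihilator ≤ n + 1 := by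
    rw [← h.invariants.2 q hq]
    have he : range (fun i => dform (E := E) (xfun χ i) q) ∪ {dform p q} =
        range (Sum.elim (fun i => dform (E := E) (xfun χ i) q) (fun _ : Unit => dform p q)) := by
      rw [Sum.elim_range, range_const]
    rw [he]
    refine (finrank_range_le_card _).trans ?_
    simp
  have h3 : Module.finrank ℝ (calA χ X q) ≤ 2 * n := by
    rw [calA_eq_span]
    refine (finrank_range_le_card _).trans ?_
    simp [two_mul]
  omega

theorem linearIndependent_calA (h : HasInvariants Hs χ X p) [FiniteDimensional ℝ E]
    (hq : q ∈ χ.source) : LinearIndependent ℝ (Sum.elim (fun i => ddu χ i q)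
      (fun i => bracket (ddu χ i) (X i) q)) := by
  rw [linearIndependent_iff_card_eq_finrank_span, Set.finrank, ← calA_eq_span, h.finrank_calA hq]
  simp [two_mul]

/-- 𝒜 is the common kernel of the exact forms dx_i and dp, and df [Y, Z] = 0 whenever Yf = Zf = 0.
-/
theorem isIntegrableOn_calA (h : HasInvariants Hs χ X p) [FiniteDimensional ℝ E] :
    IsIntegrableOn (calA χ X) χ.source := by
  have : CompleteSpace E := FiniteDimensional.complete ℝ E
  rintro q hq Y Z ⟨V₁, ho₁, hq₁, hs₁, hm₁⟩ ⟨V₂, ho₂, hq₂, hs₂, hm₂⟩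
  have ho := χ.open_source.inter (ho₁.inter ho₂)
  have hs₁' : SmoothOn Y (χ.source ∩ (V₁ ∩ V₂)) := hs₁.mono fun _ h => h.2.1
  have hs₂' : SmoothOn Z (χ.source ∩ (V₁ ∩ V₂)) := hs₂.mono fun _ h => h.2.2
  refine (h.mem_calA hq _).2 ⟨fun i => ?_, ?_⟩
  · exact dform_bracket_of_const ho hs₁' hs₂' ((contMDiffOn_xfun χ i).mono inter_subset_left)
      (fun q' hq' => ((h.mem_calA hq'.1 _).1 (hm₁ q' hq'.2.1)).1 i)
      (fun q' hq' => ((h.mem_calA hq'.1 _).1 (hm₂ q' hq'.2.2)).1 i) ⟨hq, hq₁, hq₂⟩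
  · exact dform_bracket_of_const ho hs₁' hs₂' (h.invariants.1.mono inter_subset_left)
      (fun q' hq' => ((h.mem_calA hq'.1 _).1 (hm₁ q' hq'.2.1)).2)
      (fun q' hq' => ((h.mem_calA hq'.1 _).1 (hm₂ q' hq'.2.2)).2) ⟨hq, hq₁, hq₂⟩

theorem total_eq (h : HasInvariants Hs χ X p) (hq : q ∈ χ.source) : total Hs q =
    Submodule.span ℝ (range fun i => X i q) ⊔ Submodule.span ℝ (range fun i => ddu χ i q) := by
  have h1 : ∀ i, Hs i q = Submodule.span ℝ {X i q} ⊔ Submodule.span ℝ {ddu χ i q} := fun i => by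
    rw [(h.adapted.basis i q hq).2, Submodule.span_insert]
  simp only [total, h1, iSup_sup_eq, Submodule.span_range_eq_iSup]

theorem X_mem_Hs (h : HasInvariants Hs χ X p) (hq : q ∈ χ.source) (i : Fin n) :
    X i q ∈ Hs i q := by
  rw [(h.adapted.basis i q hq).2]
  exact Submodule.subset_span (by simp)

theorem ddu_mem_Hs (h : HasInvariants Hs χ X p) (hq : q ∈ χ.source) (i : Fin n) :
    ddu χ i q ∈ Hs i q := by
  rw [(h.adapted.basis i q hq).2]
  exact Submodule.subset_span (by simp)

theorem X_mem (h : HasInvariants Hs χ X p) (hq : q ∈ χ.source) (i : Fin n) :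
    X i q ∈ total Hs q := Submodule.mem_iSup_of_mem i (h.X_mem_Hs hq i)

theorem ddu_mem (h : HasInvariants Hs χ X p) (hq : q ∈ χ.source) (i : Fin n) :
    ddu χ i q ∈ total Hs q := Submodule.mem_iSup_of_mem i (h.ddu_mem_Hs hq i)

theorem isLocalSection_X (h : HasInvariants Hs χ X p) (hq : q ∈ χ.source) (i : Fin n) :
    IsLocalSection (total Hs) q (X i) :=
  ⟨χ.source, χ.open_source, hq, h.adapted.smooth i, fun _ hq' => h.X_mem hq' i⟩

theorem mem_span_ddu (h : HasInvariants Hs χ X p) (hq : q ∈ χ.source)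
    {v : TangentSpace 𝓘(ℝ, E) q} (hv : v ∈ total Hs q) (hx : ∀ i, dform (xfun χ i) q v = 0) :
    v ∈ Submodule.span ℝ (range fun i => ddu χ i q) := by
  rw [h.total_eq hq] at hv
  obtain ⟨y, hy, z, hz, rfl⟩ := Submodule.mem_sup.1 hv
  obtain ⟨b, rfl⟩ := (Submodule.mem_span_range_iff_exists_fun ℝ).1 hy
  obtain ⟨c, rfl⟩ := (Submodule.mem_span_range_iff_exists_fun ℝ).1 hz
  have hb : ∀ i, b i = 0 := by
    intro i
    have := hx i
    rw [map_add, map_sum, map_sum] at this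
    simpa [h.dx_X hq, dx_ddu χ hq] using this
  simpa [hb] using hz

theorem contMDiffOn_p1 (h : HasInvariants Hs χ X p) (i : Fin n) :
    ContMDiffOn 𝓘(ℝ, E) 𝓘(ℝ, ℝ) ∞ (p1 X p i) χ.source :=
  contMDiffOn_der χ.open_source (h.adapted.smooth i) h.invariants.1

theorem contMDiffOn_p2 (h : HasInvariants Hs χ X p) (i j : Fin n) :
    ContMDiffOn 𝓘(ℝ, E) 𝓘(ℝ, ℝ) ∞ (p2 X p i j) χ.source :=
  contMDiffOn_der χ.open_source (h.adapted.smooth j) (h.contMDiffOn_p1 i)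

variable [FiniteDimensional ℝ E]

theorem smoothOn_ddu (χ : CoordSystem n E M) (i : Fin n) : SmoothOn (ddu χ i) χ.source :=
  have : CompleteSpace E := FiniteDimensional.complete ℝ E
  smoothOn_coordField χ _

theorem isLocalSection_ddu (h : HasInvariants Hs χ X p) (hq : q ∈ χ.source) (i : Fin n) :
    IsLocalSection (total Hs) q (ddu χ i) :=
  ⟨χ.source, χ.open_source, hq, smoothOn_ddu χ i, fun _ hq' => h.ddu_mem hq' i⟩

/-- Hyperbolicity places the bracket in H. Both fields have constant dx_k-components, so every dx_k
kills it, and only ∂/∂u-components remain. -/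
theorem bracket_ddu_X_mem (h : HasInvariants Hs χ X p) (hq : q ∈ χ.source) {i j : Fin n}
    (hij : i ≠ j) :
    bracket (ddu χ i) (X j) q ∈ Submodule.span ℝ (range fun i => ddu χ i q) := by
  have : CompleteSpace E := FiniteDimensional.complete ℝ E
  refine h.mem_span_ddu hq (h.hyperbolic.bracket_ne i j hij q _ _
    ⟨χ.source, χ.open_source, hq, smoothOn_ddu χ i, fun _ hq' => h.ddu_mem_Hs hq' i⟩
    ⟨χ.source, χ.open_source, hq, h.adapted.smooth j, fun _ hq' => h.X_mem_Hs hq' j⟩) fun k => ?_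
  exact dform_bracket_of_const χ.open_source (smoothOn_ddu χ i) (h.adapted.smooth j)
    (contMDiffOn_xfun χ k) (fun _ hq' => dx_ddu χ hq' i k) (fun _ hq' => h.dx_X hq' j k) hq

theorem bracket_X_X_mem (h : HasInvariants Hs χ X p) (hq : q ∈ χ.source) (i j : Fin n) :
    bracket (X i) (X j) q ∈ Submodule.span ℝ (range fun i => ddu χ i q) := by
  have : CompleteSpace E := FiniteDimensional.complete ℝ E
  by_cases hij : i = j
  · subst hij
    have : bracket (X i) (X i) q = 0 := by simp [bracket]
    rw [this]
    exact Submodule.zero_mem _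
  refine h.mem_span_ddu hq (h.hyperbolic.bracket_ne i j hij q _ _
    ⟨χ.source, χ.open_source, hq, h.adapted.smooth i, fun _ hq' => h.X_mem_Hs hq' i⟩
    ⟨χ.source, χ.open_source, hq, h.adapted.smooth j, fun _ hq' => h.X_mem_Hs hq' j⟩) fun k => ?_
  exact dform_bracket_of_const χ.open_source (h.adapted.smooth i) (h.adapted.smooth j)
    (contMDiffOn_xfun χ k) (fun _ hq' => h.dx_X hq' i k) (fun _ hq' => h.dx_X hq' j k) hq

theorem smoothOn_bracket_ddu_X (h : HasInvariants Hs χ X p) (i : Fin n) :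
    SmoothOn (bracket (ddu χ i) (X i)) χ.source :=
  have : CompleteSpace E := FiniteDimensional.complete ℝ E
  (smoothOn_ddu χ i).bracket χ.open_source (h.adapted.smooth i)

theorem dp_ddu (h : HasInvariants Hs χ X p) (hq : q ∈ χ.source) (i : Fin n) :
    dform p q (ddu χ i q) = 0 :=
  ((h.mem_calA hq _).1 (Submodule.subset_span (Or.inl ⟨i, rfl⟩))).2

theorem dp_bracket (h : HasInvariants Hs χ X p) (hq : q ∈ χ.source) (i : Fin n) :
    dform p q (bracket (ddu χ i) (X i) q) = 0 :=
  ((h.mem_calA hq _).1 (Submodule.subset_span (Or.inr ⟨i, rfl⟩))).2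

theorem dx_bracket (h : HasInvariants Hs χ X p) (hq : q ∈ χ.source) (i j : Fin n) :
    dform (xfun χ j) q (bracket (ddu χ i) (X i) q) = 0 :=
  ((h.mem_calA hq _).1 (Submodule.subset_span (Or.inr ⟨i, rfl⟩))).1 j

/-- Since ∂p/∂u_k = 0, differentiating X_i p along ∂/∂u_k gives [∂/∂u_k, X_i] p. The bracket is a
generator of 𝒜 if k = i and a combination of the ∂/∂u otherwise, so it annihilates p in both cases.
-/
theorem dp1_ddu (h : HasInvariants Hs χ X p) (hq : q ∈ χ.source) (i k : Fin n) :
    dform (p1 X p i) q (ddu χ k q) = 0 := by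
  have : CompleteSpace E := FiniteDimensional.complete ℝ E
  refine (dform_bracket_of_left_const χ.open_source (smoothOn_ddu χ k) (h.adapted.smooth i)
    h.invariants.1 (fun _ hq' => h.dp_ddu hq' k) hq).symm.trans ?_
  by_cases hki : k = i
  · subst hki
    exact h.dp_bracket hq k
  · exact dform_eq_zero_of_mem_span (h.dp_ddu hq) (h.bracket_ddu_X_mem hq hki)

/-- The commutator [X_j, X_i] is a combination of the ∂/∂u_k, along which p is constant. -/
theorem p2_comm (h : HasInvariants Hs χ X p) (hq : q ∈ χ.source) (i j : Fin n) :
    p2 X p i j q = p2 X p j i q := by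
  have : CompleteSpace E := FiniteDimensional.complete ℝ E
  have h1 := der_bracket χ.open_source (h.adapted.smooth j) (h.adapted.smooth i)
    h.invariants.1 hq
  have h2 : der (bracket (X j) (X i)) p q = 0 :=
    dform_eq_zero_of_mem_span (h.dp_ddu hq) (h.bracket_X_X_mem hq j i)
  exact sub_eq_zero.1 (h1.symm.trans h2)

theorem pSym_eq (h : HasInvariants Hs χ X p) (hq : q ∈ χ.source) (i j : Fin n) :
    pSym X p s(i, j) q = p2 X p i j q := by
  rcases le_total i j with hij | hij
  · simp [pSym, hij]
  · simp only [pSym, Sym2.inf_mk, Sym2.sup_mk, inf_eq_right.2 hij, sup_eq_left.2 hij]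
    exact h.p2_comm hq j i

theorem dform_p2_comm (h : HasInvariants Hs χ X p) (hq : q ∈ χ.source) (i j : Fin n) :
    dform (E := E) (p2 X p i j) q = dform (p2 X p j i) q :=
  dform_congr (by filter_upwards [χ.open_source.mem_nhds hq] with q' hq' using h.p2_comm hq' i j)

theorem dform_pSym (h : HasInvariants Hs χ X p) (hq : q ∈ χ.source) (i j : Fin n) :
    dform (E := E) (pSym X p s(i, j)) q = dform (p2 X p i j) q :=
  dform_congr (by filter_upwards [χ.open_source.mem_nhds hq] with q' hq' using h.pSym_eq hq' i j)

theorem dp2_ddu (h : HasInvariants Hs χ X p) (hq : q ∈ χ.source) (i j k : Fin n) :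
    dform (p2 X p i j) q (ddu χ k q) = dform (p1 X p i) q (bracket (ddu χ k) (X j) q) :=
  have : CompleteSpace E := FiniteDimensional.complete ℝ E
  (dform_bracket_of_left_const χ.open_source (smoothOn_ddu χ k) (h.adapted.smooth j)
    (h.contMDiffOn_p1 i) (fun _ hq' => h.dp1_ddu hq' i k) hq).symm

theorem dp2_ddu_of_ne (h : HasInvariants Hs χ X p) (hq : q ∈ χ.source) {i j k : Fin n}
    (hkj : k ≠ j) : dform (p2 X p i j) q (ddu χ k q) = 0 := by
  rw [h.dp2_ddu hq]
  exact dform_eq_zero_of_mem_span (h.dp1_ddu hq i) (h.bracket_ddu_X_mem hq hkj)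

/-- The value is ∂p_ij/∂u_j, which equals ∂p_ji/∂u_j by symmetry; this is zero because ∂/∂u_j
commutes with X_i modulo the ∂/∂u. Symmetry is thus the source of the diagonal tableau. -/
theorem dp1_bracket_of_ne (h : HasInvariants Hs χ X p) (hq : q ∈ χ.source) {i j : Fin n}
    (hij : i ≠ j) : dform (p1 X p i) q (bracket (ddu χ j) (X j) q) = 0 := by
  rw [← h.dp2_ddu hq, h.dform_p2_comm hq, h.dp2_ddu_of_ne hq hij.symm]

end HasInvariants
end Invariants

/-! ### Smooth one-forms, and exterior derivatives on a distribution -/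

section SmoothForms

variable {E : Type*} [NormedAddCommGroup E] [NormedSpace ℝ E]
  {M : Type*} [TopologicalSpace M] [ChartedSpace E M] [IsManifold 𝓘(ℝ, E) ∞ M] {U : Set M}

theorem smoothFormOn_dform {f : M → ℝ} (hf : ContMDiffOn 𝓘(ℝ, E) 𝓘(ℝ, ℝ) ∞ f U) :
    SmoothFormOn (dform (E := E) f) U :=
  fun _ hV hVU _ hY => contMDiffOn_der hV hY (hf.mono hVU)

theorem SmoothFormOn.sub {α β : OneForm E M} (hα : SmoothFormOn α U) (hβ : SmoothFormOn β U) :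
    SmoothFormOn (fun q => α q - β q) U :=
  fun V hV hVU Y hY => (hα V hV hVU Y hY).sub (hβ V hV hVU Y hY)

theorem SmoothFormOn.smul {f : M → ℝ} {α : OneForm E M}
    (hf : ContMDiffOn 𝓘(ℝ, E) 𝓘(ℝ, ℝ) ∞ f U) (hα : SmoothFormOn α U) :
    SmoothFormOn (fun q => f q • α q) U :=
  fun V hV hVU Y hY => (hf.mono hVU).mul (hα V hV hVU Y hY)

theorem SmoothFormOn.sum {ι : Type*} [Fintype ι] {α : ι → OneForm E M}
    (hα : ∀ i, SmoothFormOn (α i) U) : SmoothFormOn (fun q => ∑ i, α i q) U := by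
  intro V hV hVU Y hY
  have h : ContMDiffOn 𝓘(ℝ, E) 𝓘(ℝ, ℝ) ∞ (fun q => ∑ i, α i q (Y q)) V :=
    contMDiffOn_finsetSum fun i _ => hα i V hV hVU Y hY
  refine h.congr fun q _ => ?_
  rw [LinearMap.sum_apply]

/-- The functions θ(Y) and θ(Z) vanish near `q`, so only the bracket term of the exterior derivative
survives. -/
theorem extD_of_mem {D : Distribution E M} {θ : OneForm E M} (hU : IsOpen U)
    (hθ : ∀ q ∈ U, ∀ v ∈ D q, θ q v = 0) {q : M} (hq : q ∈ U) {Y Z : VField E M}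
    (hY : IsLocalSection D q Y) (hZ : IsLocalSection D q Z) :
    extD θ Y Z q = -θ q (bracket Y Z q) := by
  have key : ∀ Y Z : VField E M, IsLocalSection D q Y →
      der Z (fun q' => θ q' (Y q')) q = 0 := by
    rintro Y Z ⟨V, hV, hqV, -, hm⟩
    have e : (fun q' => θ q' (Y q')) =ᶠ[𝓝 q] fun _ => 0 := by
      filter_upwards [(hU.inter hV).mem_nhds ⟨hq, hqV⟩] with q' hq'
      exact hθ q' hq'.1 _ (hm q' hq'.2)
    rw [der, dform_congr e, dform_const]
    rfl
  rw [extD, key Y Z hY, key Z Y hZ, sub_zero, zero_sub]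

end SmoothForms

/-! ### Nonvanishing of a_i, and H as the kernel of the contact forms -/

section Invariants

variable {E : Type*} [NormedAddCommGroup E] [NormedSpace ℝ E]
  {M : Type*} [TopologicalSpace M] [ChartedSpace E M] [IsManifold 𝓘(ℝ, E) ∞ M] {n : ℕ}

/-- The functions `a_i = [∂/∂u_i, X_i] p_i`. -/
noncomputable def aFun (χ : CoordSystem n E M) (X : Fin n → VField E M) (p : M → ℝ)
    (i : Fin n) : M → ℝ :=
  der (bracket (ddu χ i) (X i)) (p1 X p i)

namespace HasInvariants

variable {Hs : Fin n → Distribution E M} {χ : CoordSystem n E M} {X : Fin n → VField E M}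
  {p : M → ℝ} {q : M} [FiniteDimensional ℝ E]

theorem contMDiffOn_aFun (h : HasInvariants Hs χ X p) (i : Fin n) :
    ContMDiffOn 𝓘(ℝ, E) 𝓘(ℝ, ℝ) ∞ (aFun χ X p i) χ.source :=
  contMDiffOn_der χ.open_source (h.smoothOn_bracket_ddu_X i) (h.contMDiffOn_p1 i)

theorem dp1_bracket (h : HasInvariants Hs χ X p) (hq : q ∈ χ.source) (i j : Fin n) :
    dform (p1 X p j) q (bracket (ddu χ i) (X i) q) = if i = j then aFun χ X p i q else 0 := by
  by_cases hij : i = j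
  · subst hij; rw [if_pos rfl]; rfl
  · rw [if_neg hij, h.dp1_bracket_of_ne hq (Ne.symm hij)]

theorem dpSym_ddu (h : HasInvariants Hs χ X p) (hq : q ∈ χ.source) (s : Sym2 (Fin n))
    (k : Fin n) :
    dform (pSym X p s) q (ddu χ k q) = if s = s(k, k) then aFun χ X p k q else 0 := by
  induction s using Sym2.ind with
  | _ i j =>
    rw [h.dform_pSym hq]
    by_cases hkj : k = j
    · subst hkj
      rw [h.dp2_ddu hq, h.dp1_bracket hq]
      exact if_congr (by simp [eq_comm]) rfl rfl
    · rw [h.dp2_ddu_of_ne hq hkj, if_neg]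
      simp only [Sym2.eq_iff, or_self, not_and]
      exact fun _ hj => hkj hj.symm

/-- Only one inclusion is available here, checked on the spanning fields. The converse needs a_i ≠
0, and the proof of that uses this inclusion. -/
theorem isJetSubsystem (h : HasInvariants Hs χ X p) :
    IsJetSubsystem (total Hs) χ.source (xfun χ) p (p1 X p) (pSym X p) where
  isOpen := χ.open_source
  smooth_x := contMDiffOn_xfun χ
  smooth_u := h.invariants.1
  smooth_u₁ := h.contMDiffOn_p1
  smooth_u₂ _ := h.contMDiffOn_p2 _ _
  contact_of_mem q hq v hv := by
    rw [h.total_eq hq] at hv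
    obtain ⟨y, hy, z, hz, rfl⟩ := Submodule.mem_sup.1 hv
    obtain ⟨b, rfl⟩ := (Submodule.mem_span_range_iff_exists_fun ℝ).1 hy
    obtain ⟨c, rfl⟩ := (Submodule.mem_span_range_iff_exists_fun ℝ).1 hz
    have e0 : ∀ i, dform p q (X i q) = p1 X p i q := fun _ => rfl
    have e1 : ∀ i j, dform (p1 X p i) q (X j q) = p2 X p i j q := fun _ _ => rfl
    constructor
    · simp only [map_add, map_sum]
      simp [dx_ddu χ hq, h.dx_X hq, h.dp_ddu hq, e0, mul_comm]
    · intro i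
      simp only [map_add, map_sum]
      simp [dx_ddu χ hq, h.dx_X hq, h.dp1_ddu hq, e1, h.pSym_eq hq, mul_comm]

theorem bracket_mem_derived (h : HasInvariants Hs χ X p) (hq : q ∈ χ.source) (i : Fin n) :
    bracket (ddu χ i) (X i) q ∈ derived (total Hs) q :=
  Submodule.mem_sup_right (Submodule.subset_span
    ⟨_, _, h.isLocalSection_ddu hq i, h.isLocalSection_X hq i, rfl⟩)

/-- Brackets of sections of H satisfy the equation by `dform_u_bracket`. Conversely, subtracting the
X-components of a solution leaves a vector killed by dx_i and dp, hence in 𝒜, whose generators lie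
in H⁽¹⁾. -/
theorem mem_derived_iff (h : HasInvariants Hs χ X p) (hq : q ∈ χ.source)
    (v : TangentSpace 𝓘(ℝ, E) q) :
    v ∈ derived (total Hs) q ↔ dform p q v = ∑ i, p1 X p i q * dform (xfun χ i) q v := by
  have : CompleteSpace E := FiniteDimensional.complete ℝ E
  constructor
  · intro hv
    have hle : derived (total Hs) q ≤ LinearMap.ker (dform p q -
        ∑ i, p1 X p i q • dform (xfun χ i) q) := by
      refine sup_le (fun w hw => ?_) (Submodule.span_le.2 ?_)
      · rw [LinearMap.mem_ker, LinearMap.sub_apply, LinearMap.sum_apply,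
          (h.isJetSubsystem.contact_of_mem q hq w hw).1]
        simp
      · rintro _ ⟨Y, Z, hY, hZ, rfl⟩
        rw [SetLike.mem_coe, LinearMap.mem_ker, LinearMap.sub_apply, LinearMap.sum_apply,
          h.isJetSubsystem.dform_u_bracket hq hY hZ]
        simp
    have := hle hv
    rw [LinearMap.mem_ker, LinearMap.sub_apply, LinearMap.sum_apply] at this
    simpa using sub_eq_zero.1 this
  · intro hv
    set w := v - ∑ k, dform (xfun χ k) q v • X k q with hw
    have hwA : w ∈ calA χ X q := by
      refine (h.mem_calA hq w).2 ⟨fun i => ?_, ?_⟩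
      · rw [hw, map_sub, map_sum]
        simp [h.dx_X hq]
      · have e0 : ∀ i, dform p q (X i q) = p1 X p i q := fun _ => rfl
        rw [hw, map_sub, map_sum, hv]
        simp [e0, mul_comm]
    have hle : calA χ X q ≤ derived (total Hs) q := by
      refine Submodule.span_le.2 ?_
      rintro _ (⟨i, rfl⟩ | ⟨i, rfl⟩)
      · exact Submodule.mem_sup_left (h.ddu_mem hq i)
      · exact h.bracket_mem_derived hq i
    have hv' : v = w + ∑ k, dform (xfun χ k) q v • X k q := by rw [hw]; abel
    rw [hv']
    exact Submodule.add_mem _ (hle hwA) (Submodule.sum_mem _ fun k _ =>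
      Submodule.smul_mem _ _ (Submodule.mem_sup_left (h.X_mem hq k)))

/-- If a_i vanishes at `q`, then all dx_j and dp_j kill B_i = [∂/∂u_i, X_i] there. So ∑ dp_j ∧ dx_j
contracts to zero with B_i, which makes it a Cauchy characteristic vector of H⁽¹⁾ at `q`. It then
lies in the span of the ∂/∂u_k, against the independence of the generators of 𝒜. The Cauchy
condition is pointwise, so a zero at a single point suffices. -/
theorem aFun_ne_zero (h : HasInvariants Hs χ X p) (hq : q ∈ χ.source) (i : Fin n) :
    aFun χ X p i q ≠ 0 := by
  have : CompleteSpace E := FiniteDimensional.complete ℝ E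
  intro h0
  have hd : ∀ j, dform (p1 X p j) q (bracket (ddu χ i) (X i) q) = 0 := fun j => by
    rw [h.dp1_bracket hq, h0, ite_self]
  have hmem : bracket (ddu χ i) (X i) q ∈ cauchy (derived (total Hs)) q := by
    refine Submodule.subset_span ⟨bracket (ddu χ i) (X i), ⟨χ.source, χ.open_source, hq,
      h.smoothOn_bracket_ddu_X i, fun _ hq' => h.bracket_mem_derived hq' i⟩, rfl, ?_⟩
    rintro Z ⟨V, hV, hqV, hZ, hm⟩
    rw [h.mem_derived_iff hq]
    rw [der_bracket_of_contact (V := χ.source ∩ V) (a := p1 X p) (x := xfun χ)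
      (χ.open_source.inter hV) ((h.smoothOn_bracket_ddu_X i).mono inter_subset_left)
      (hZ.mono inter_subset_right) (h.invariants.1.mono inter_subset_left)
      (fun j => (h.contMDiffOn_p1 j).mono inter_subset_left)
      (fun j => (contMDiffOn_xfun χ j).mono inter_subset_left)
      (fun q' hq' => (h.mem_derived_iff hq'.1 _).1 (h.bracket_mem_derived hq'.1 i))
      (fun q' hq' => (h.mem_derived_iff hq'.1 _).1 (hm q' hq'.2)) ⟨hq, hqV⟩]
    simp [hd, h.dx_bracket hq]
  rw [h.adapted.cauchy_eq q hq] at hmem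
  have hnot := (h.linearIndependent_calA hq).notMem_span_image
    (s := range Sum.inl) (x := Sum.inr i) (by simp)
  refine hnot ?_
  rw [← range_comp]
  exact hmem

/-- A vector killed by the contact forms, minus its X-components, lies in 𝒜 and is killed by every
dp_i. Its coefficient c_i along B_i satisfies c_i a_i = 0, so only ∂/∂u-components remain. -/
theorem isJetSystem (h : HasInvariants Hs χ X p) :
    IsJetSystem (total Hs) χ.source (xfun χ) p (p1 X p) (pSym X p) where
  toIsJetSubsystem := h.isJetSubsystem
  mem_of_contact q hq v hv hv₁ := by
    set w := v - ∑ k, dform (xfun χ k) q v • X k q with hw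
    have e0 : ∀ i, dform p q (X i q) = p1 X p i q := fun _ => rfl
    have e1 : ∀ i j, dform (p1 X p i) q (X j q) = p2 X p i j q := fun _ _ => rfl
    have hwA : w ∈ calA χ X q := by
      refine (h.mem_calA hq w).2 ⟨fun i => ?_, ?_⟩
      · rw [hw, map_sub, map_sum]
        simp [h.dx_X hq]
      · rw [hw, map_sub, map_sum, hv]
        simp [e0, mul_comm]
    have hw₁ : ∀ i, dform (p1 X p i) q w = 0 := fun i => by
      rw [hw, map_sub, map_sum, hv₁]
      simp [e1, h.pSym_eq hq, mul_comm]
    obtain ⟨b, c, hbc⟩ := (mem_calA_iff_exists χ X).1 hwA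
    have hc : ∀ i, c i = 0 := fun i => by
      have h1 := hw₁ i
      rw [hbc, map_add, map_sum, map_sum] at h1
      simpa [h.dp1_ddu hq, h.dp1_bracket hq, h.aFun_ne_zero hq] using h1
    have hv' : v = w + ∑ k, dform (xfun χ k) q v • X k q := by rw [hw]; abel
    rw [hv', hbc]
    simp only [hc, zero_smul, Finset.sum_const_zero, add_zero]
    exact Submodule.add_mem _ (Submodule.sum_mem _ fun k _ =>
      Submodule.smul_mem _ _ (h.ddu_mem hq k)) (Submodule.sum_mem _ fun k _ =>
      Submodule.smul_mem _ _ (h.X_mem hq k))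

theorem isJetFrameAt (h : HasInvariants Hs χ X p) (hq : q ∈ χ.source) :
    IsJetFrameAt (total Hs) (xfun χ) p (p1 X p) (pSym X p) q X (ddu χ)
      (fun i => bracket (ddu χ i) (X i) q) (fun i => aFun χ X p i q) where
  section_T := h.isLocalSection_X hq
  section_V := h.isLocalSection_ddu hq
  dx_T := h.dx_X hq
  dx_V := dx_ddu χ hq
  mem_span_V _ hv hx := h.mem_span_ddu hq hv hx
  -- The commutator of X_k and X_j is a combination of the ∂/∂u, which annihilate p_i as well as p.
  du₂_T i j k := by
    have : CompleteSpace E := FiniteDimensional.complete ℝ E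
    rw [h.dform_pSym hq, h.dform_pSym hq]
    have h1 := der_bracket χ.open_source (h.adapted.smooth k) (h.adapted.smooth j)
      (h.contMDiffOn_p1 i) hq
    have h2 : der (bracket (X k) (X j)) (p1 X p i) q = 0 :=
      dform_eq_zero_of_mem_span (h.dp1_ddu hq i) (h.bracket_X_X_mem hq k j)
    exact sub_eq_zero.1 (h1.symm.trans h2)
  du₂_V := h.dpSym_ddu hq
  a_ne := h.aFun_ne_zero hq
  dx_B := h.dx_bracket hq
  du_B := h.dp_bracket hq
  du₁_B := h.dp1_bracket hq

/-- The differentials of `x_i, p, p_i, p_{ii}` have no common kernel. -/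
theorem eq_zero_of_dform_eq_zero (h : HasInvariants Hs χ X p) (hq : q ∈ χ.source)
    {v : TangentSpace 𝓘(ℝ, E) q} (hx : ∀ i, dform (xfun χ i) q v = 0) (hp : dform p q v = 0)
    (hp₁ : ∀ i, dform (p1 X p i) q v = 0) (hp₂ : ∀ i, dform (pSym X p s(i, i)) q v = 0) :
    v = 0 := by
  have hv : v ∈ total Hs q := by
    refine (h.isJetSystem.mem_iff hq v).2 ⟨?_, fun i => ?_⟩
    · simp [hx, hp]
    · simp [hx, hp₁]
  rw [(h.isJetFrameAt hq).eq_sum hv]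
  simp [hx, hp₂, jetPi_apply]

end HasInvariants
end Invariants

/-! ### Inverse function theorem in local-diffeomorphism form -/

section InverseFunction

theorem isLocalDiffeomorphAt_congr {E F M : Type*} [NormedAddCommGroup E] [NormedSpace ℝ E]
    [NormedAddCommGroup F] [NormedSpace ℝ F] [TopologicalSpace M] [ChartedSpace E M]
    {f g : M → F} {q : M} (hf : IsLocalDiffeomorphAt 𝓘(ℝ, E) 𝓘(ℝ, F) ∞ f q) {S : Set M}
    (hS : IsOpen S) (hq : q ∈ S) (hfg : EqOn g f S) :
    IsLocalDiffeomorphAt 𝓘(ℝ, E) 𝓘(ℝ, F) ∞ g q := by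
  obtain ⟨Ψ, hΨ, heq⟩ := hf
  let e := Ψ.toOpenPartialHomeomorph.restrOpen S hS
  have hsrc : e.source ⊆ Ψ.source := fun z hz => hz.1
  have htgt : e.target ⊆ Ψ.target := fun z hz => hz.1
  exact ⟨{ toPartialEquiv := e.toPartialEquiv
           open_source := e.open_source
           open_target := e.open_target
           contMDiffOn_toFun := Ψ.contMDiffOn_toFun.mono hsrc
           contMDiffOn_invFun := Ψ.contMDiffOn_invFun.mono htgt }, ⟨hΨ, hq⟩,
    fun z hz => (hfg hz.2).trans (heq hz.1)⟩

variable {F G : Type*} [NormedAddCommGroup F] [NormedSpace ℝ F] [FiniteDimensional ℝ F]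
  [NormedAddCommGroup G] [NormedSpace ℝ G] [FiniteDimensional ℝ G]

/-- The inverse function theorem: a smooth map whose differential is injective, between spaces of
equal dimensions, is a local diffeomorphism. -/
theorem isLocalDiffeomorphAt_of_injective (hdim : Module.finrank ℝ F = Module.finrank ℝ G)
    {g : F → G} {S : Set F} (hS : IsOpen S) (hg : ContDiffOn ℝ ∞ g S)
    (hinj : ∀ y ∈ S, Function.Injective (fderiv ℝ g y)) {y : F} (hy : y ∈ S) :
    IsLocalDiffeomorphAt 𝓘(ℝ, F) 𝓘(ℝ, G) ∞ g y := by
  have : CompleteSpace F := FiniteDimensional.complete ℝ F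
  have hat : ∀ z ∈ S, ContDiffAt ℝ ∞ g z := fun z hz => hg.contDiffAt (hS.mem_nhds hz)
  have hequiv : ∀ z ∈ S, ∃ L : F ≃L[ℝ] G, HasFDerivAt g (L : F →L[ℝ] G) z := by
    intro z hz
    let L₀ := LinearEquiv.ofInjectiveOfFinrankEq (fderiv ℝ g z : F →ₗ[ℝ] G) (hinj z hz) hdim
    refine ⟨L₀.toContinuousLinearEquiv, ?_⟩
    have hd := ((hat z hz).differentiableAt (by simp)).hasFDerivAt
    convert hd using 1
    ext v
    rfl
  obtain ⟨L, hL⟩ := hequiv y hy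
  let e := (hat y hy).toOpenPartialHomeomorph g hL (by simp)
  have he : ∀ z, e z = g z := fun z => rfl
  -- Inside `S` the derivative is invertible at every point of the source, so the inverse is smooth
  -- on the whole target and not only at the image of `y`.
  let e' := e.restrOpen S hS
  have hsub : e'.source ⊆ S := fun z hz => hz.2
  refine ⟨{ toPartialEquiv := e'.toPartialEquiv
            open_source := e'.open_source
            open_target := e'.open_target
            contMDiffOn_toFun := (hg.mono hsub).contMDiffOn
            contMDiffOn_invFun := ContDiffOn.contMDiffOn fun w hw => ?_ }, ?_, fun z _ => rfl⟩
  · have hz : e'.symm w ∈ S := hsub (e'.map_target hw)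
    obtain ⟨L', hL'⟩ := hequiv _ hz
    exact (e'.contDiffAt_symm hw hL' (hat _ hz)).contDiffWithinAt
  · exact ⟨(hat y hy).mem_toOpenPartialHomeomorph_source hL (by simp), hy⟩

end InverseFunction

/-! ### The maps φ and Φ and their differentials -/

section Invariants

variable {E : Type*} [NormedAddCommGroup E] [NormedSpace ℝ E]
  {M : Type*} [TopologicalSpace M] [ChartedSpace E M] {n : ℕ}

theorem p2_self_eq (X : Fin n → VField E M) (p : M → ℝ) (i : Fin n) :
    p2 X p i i = pSym X p s(i, i) := by
  simp [pSym]

variable [IsManifold 𝓘(ℝ, E) ∞ M]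

namespace HasInvariants

variable {Hs : Fin n → Distribution E M} {χ : CoordSystem n E M} {X : Fin n → VField E M}
  {p : M → ℝ} {q : M}

theorem contMDiffOn_phi (h : HasInvariants Hs χ X p) :
    ContMDiffOn 𝓘(ℝ, E) 𝓘(ℝ, JDiag n) ∞ (phi χ X p) χ.source :=
  (contMDiffOn_pi_space.2 (contMDiffOn_xfun χ)).prodMk_space
    (h.invariants.1.prodMk_space ((contMDiffOn_pi_space.2 h.contMDiffOn_p1).prodMk_space
      (contMDiffOn_pi_space.2 fun i => h.contMDiffOn_p2 i i)))

theorem contMDiffOn_Phi (h : HasInvariants Hs χ X p) :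
    ContMDiffOn 𝓘(ℝ, E) 𝓘(ℝ, J2 n) ∞ (Phi χ X p) χ.source :=
  (contMDiffOn_pi_space.2 (contMDiffOn_xfun χ)).prodMk_space
    (h.invariants.1.prodMk_space ((contMDiffOn_pi_space.2 h.contMDiffOn_p1).prodMk_space
      (contMDiffOn_pi_space.2 fun _ => h.contMDiffOn_p2 _ _)))

theorem mdifferentiableAt_phi (h : HasInvariants Hs χ X p) (hq : q ∈ χ.source) :
    MDifferentiableAt 𝓘(ℝ, E) 𝓘(ℝ, JDiag n) (phi χ X p) q :=
  (h.contMDiffOn_phi.contMDiffAt (χ.open_source.mem_nhds hq)).mdifferentiableAt (by simp)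

theorem mdifferentiableAt_Phi (h : HasInvariants Hs χ X p) (hq : q ∈ χ.source) :
    MDifferentiableAt 𝓘(ℝ, E) 𝓘(ℝ, J2 n) (Phi χ X p) q :=
  (h.contMDiffOn_Phi.contMDiffAt (χ.open_source.mem_nhds hq)).mdifferentiableAt (by simp)

theorem finrank_eq_JDiag (h : HasInvariants Hs χ X p) :
    Module.finrank ℝ E = Module.finrank ℝ (JDiag n) := by
  rw [h.hyperbolic.dim_eq]
  simp [JDiag]
  ring

theorem mfderiv_phi (h : HasInvariants Hs χ X p) (hq : q ∈ χ.source)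
    (v : TangentSpace 𝓘(ℝ, E) q) :
    mfderiv 𝓘(ℝ, E) 𝓘(ℝ, JDiag n) (phi χ X p) q v =
      ((fun i => dform (xfun χ i) q v, dform p q v, fun i => dform (p1 X p i) q v,
        fun i => dform (pSym X p s(i, i)) q v) : JDiag n) := by
  have hd := fun L => dform_clm_comp (h.mdifferentiableAt_phi hq) L v
  let π₁ := ContinuousLinearMap.fst ℝ (Fin n → ℝ) (ℝ × (Fin n → ℝ) × (Fin n → ℝ))
  let π₂ := ContinuousLinearMap.snd ℝ (Fin n → ℝ) (ℝ × (Fin n → ℝ) × (Fin n → ℝ))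
  let π₃ := ContinuousLinearMap.snd ℝ ℝ ((Fin n → ℝ) × (Fin n → ℝ))
  refine Prod.ext (funext fun i => ?_) (Prod.ext ?_ (Prod.ext (funext fun i => ?_)
    (funext fun i => ?_)))
  · exact (hd ((ContinuousLinearMap.proj i).comp π₁)).symm
  · exact (hd ((ContinuousLinearMap.fst ℝ _ _).comp π₂)).symm
  · exact (hd ((ContinuousLinearMap.proj i).comp
      ((ContinuousLinearMap.fst ℝ _ _).comp (π₃.comp π₂)))).symm
  · have e : dform (p2 X p i i) q v = dform (pSym X p s(i, i)) q v := by rw [p2_self_eq]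
    exact (hd ((ContinuousLinearMap.proj i).comp
      ((ContinuousLinearMap.snd ℝ _ _).comp (π₃.comp π₂)))).symm.trans e

theorem dPhi_apply (h : HasInvariants Hs χ X p) (hq : q ∈ χ.source)
    (v : TangentSpace 𝓘(ℝ, E) q) :
    dPhi χ X p q v =
      ((fun i => dform (xfun χ i) q v, dform p q v, fun i => dform (p1 X p i) q v,
        fun s => dform (pSym X p s) q v) : J2 n) := by
  have hd := fun L => dform_clm_comp (h.mdifferentiableAt_Phi hq) L v
  let π₁ := ContinuousLinearMap.fst ℝ (Fin n → ℝ) (ℝ × (Fin n → ℝ) × (Sym2 (Fin n) → ℝ))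
  let π₂ := ContinuousLinearMap.snd ℝ (Fin n → ℝ) (ℝ × (Fin n → ℝ) × (Sym2 (Fin n) → ℝ))
  let π₃ := ContinuousLinearMap.snd ℝ ℝ ((Fin n → ℝ) × (Sym2 (Fin n) → ℝ))
  refine Prod.ext (funext fun i => ?_) (Prod.ext ?_ (Prod.ext (funext fun i => ?_)
    (funext fun s => ?_)))
  · exact (hd ((ContinuousLinearMap.proj i).comp π₁)).symm
  · exact (hd ((ContinuousLinearMap.fst ℝ _ _).comp π₂)).symm
  · exact (hd ((ContinuousLinearMap.proj i).comp
      ((ContinuousLinearMap.fst ℝ _ _).comp (π₃.comp π₂)))).symm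
  · exact (hd ((ContinuousLinearMap.proj s).comp
      ((ContinuousLinearMap.snd ℝ _ _).comp (π₃.comp π₂)))).symm

variable [FiniteDimensional ℝ E]

theorem mfderiv_phi_injective (h : HasInvariants Hs χ X p) (hq : q ∈ χ.source) :
    Function.Injective (mfderiv 𝓘(ℝ, E) 𝓘(ℝ, JDiag n) (phi χ X p) q) := by
  refine (injective_iff_map_eq_zero _).2 fun v hv => ?_
  have hv' := (h.mfderiv_phi hq v).symm.trans hv
  have h2 := congrArg Prod.snd hv'
  have h3 := congrArg Prod.snd h2
  exact h.eq_zero_of_dform_eq_zero hq (fun i => congrFun (congrArg Prod.fst hv') i)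
    (congrArg Prod.fst h2) (fun i => congrFun (congrArg Prod.fst h3) i)
    (fun i => congrFun (congrArg Prod.snd h3) i)

theorem dPhi_injective (h : HasInvariants Hs χ X p) (hq : q ∈ χ.source) :
    Function.Injective (dPhi χ X p q) := by
  refine (injective_iff_map_eq_zero _).2 fun v hv => ?_
  have hv' := (h.dPhi_apply hq v).symm.trans hv
  have h2 := congrArg Prod.snd hv'
  have h3 := congrArg Prod.snd h2
  exact h.eq_zero_of_dform_eq_zero hq (fun i => congrFun (congrArg Prod.fst hv') i)
    (congrArg Prod.fst h2) (fun i => congrFun (congrArg Prod.fst h3) i)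
    (fun i => congrFun (congrArg Prod.snd h3) s(i, i))

theorem mfderiv_phi_surjective (h : HasInvariants Hs χ X p) (hq : q ∈ χ.source) :
    Function.Surjective (mfderiv 𝓘(ℝ, E) 𝓘(ℝ, JDiag n) (phi χ X p) q) :=
  let f : E →L[ℝ] JDiag n := mfderiv 𝓘(ℝ, E) 𝓘(ℝ, JDiag n) (phi χ X p) q
  (LinearMap.injective_iff_surjective_of_finrank_eq_finrank (f := (f : E →ₗ[ℝ] JDiag n))
    h.finrank_eq_JDiag).1 (h.mfderiv_phi_injective hq)

/-- The inverse function theorem is applied to φ ∘ χ⁻¹, a map between vector spaces of equal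
dimension 3n + 1, and the result is composed with χ. -/
theorem isLocalDiffeomorphOn_phi (h : HasInvariants Hs χ X p) :
    IsLocalDiffeomorphOn 𝓘(ℝ, E) 𝓘(ℝ, JDiag n) ∞ (phi χ X p) χ.source := by
  rintro ⟨q, hq⟩
  have hinv : ∀ y ∈ χ.target, χ.symm y ∈ χ.source := fun y hy => χ.map_target hy
  have hg : ContMDiffOn 𝓘(ℝ, Coord n) 𝓘(ℝ, JDiag n) ∞ (phi χ X p ∘ χ.symm) χ.target :=
    h.contMDiffOn_phi.comp χ.contMDiffOn_invFun hinv
  have hinj : ∀ y ∈ χ.target, Function.Injective (fderiv ℝ (phi χ X p ∘ χ.symm) y) := by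
    intro y hy
    have hc := mfderiv_comp y (h.mdifferentiableAt_phi (hinv y hy))
      (χ.symm.mdifferentiableAt (by simp) (x := y) hy)
    rw [mfderiv_eq_fderiv] at hc
    rw [hc]
    exact (h.mfderiv_phi_injective (hinv y hy)).comp
      ((χ.symm.isLocalDiffeomorphAt _ _ _ hy).mfderivToContinuousLinearEquiv
        (by simp)).injective
  have hdim : Module.finrank ℝ (Coord n) = Module.finrank ℝ (JDiag n) := by
    simp [Coord, JDiag]
    ring
  have h1 := isLocalDiffeomorphAt_of_injective hdim χ.open_target hg.contDiffOn hinj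
    (χ.map_source hq)
  refine isLocalDiffeomorphAt_congr (IsLocalDiffeomorphAt.comp
    (hf := χ.isLocalDiffeomorphAt _ _ _ hq) (hg := h1)) χ.open_source hq fun q' hq' => ?_
  exact congrArg (phi χ X p) (χ.left_inv hq').symm

theorem total_eq_comap (h : HasInvariants Hs χ X p) (hq : q ∈ χ.source) :
    total Hs q = (contact n (Phi χ X p q)).comap (dPhi χ X p q) := by
  ext v
  rw [h.isJetSystem.mem_iff hq, Submodule.mem_comap, h.dPhi_apply hq]
  exact Iff.rfl

end HasInvariants
end Invariants

/-! ### Coframe and structure equations -/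

section StructureEquations

variable {E : Type*} [NormedAddCommGroup E] [NormedSpace ℝ E]
  {M : Type*} [TopologicalSpace M] [ChartedSpace E M] {n : ℕ}

/-- The form `π_i = (dp_{ii} - ∑ (X_j p_{ii}) dx_j) / a_i`. -/
noncomputable def piForm (χ : CoordSystem n E M) (X : Fin n → VField E M) (p : M → ℝ)
    (i : Fin n) : OneForm E M := fun q =>
  jetPi (xfun χ) (pSym X p) q X (fun k => aFun χ X p k q) i

/-- The contact form `dp - ∑ p_i dx_i`. -/
noncomputable def thetaZero (χ : CoordSystem n E M) (X : Fin n → VField E M) (p : M → ℝ) :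
    OneForm E M := fun q => dform p q - ∑ i, p1 X p i q • dform (xfun χ i) q

/-- The contact form `dp_i - ∑ p_{ij} dx_j`, multiplied by `-1 / a_i`. -/
noncomputable def thetaForm (χ : CoordSystem n E M) (X : Fin n → VField E M) (p : M → ℝ)
    (i : Fin n) : OneForm E M := fun q =>
  (-(aFun χ X p i q)⁻¹) •
    (dform (p1 X p i) q - ∑ j, pSym X p s(i, j) q • dform (xfun χ j) q)

theorem thetaZero_apply (χ : CoordSystem n E M) (X : Fin n → VField E M) (p : M → ℝ) (q : M)
    (v : TangentSpace 𝓘(ℝ, E) q) :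
    thetaZero χ X p q v = dform p q v - ∑ i, p1 X p i q * dform (xfun χ i) q v := by
  rw [thetaZero, LinearMap.sub_apply, LinearMap.sum_apply]
  rfl

theorem thetaForm_apply (χ : CoordSystem n E M) (X : Fin n → VField E M) (p : M → ℝ)
    (i : Fin n) (q : M) (v : TangentSpace 𝓘(ℝ, E) q) :
    thetaForm χ X p i q v = -(aFun χ X p i q)⁻¹ *
      (dform (p1 X p i) q v - ∑ j, pSym X p s(i, j) q * dform (xfun χ j) q v) := by
  rw [thetaForm, LinearMap.smul_apply, LinearMap.sub_apply, LinearMap.sum_apply]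
  rfl

variable [IsManifold 𝓘(ℝ, E) ∞ M]

namespace HasInvariants

variable {Hs : Fin n → Distribution E M} {χ : CoordSystem n E M} {X : Fin n → VField E M}
  {p : M → ℝ} {q : M}

theorem smoothFormOn_thetaZero (h : HasInvariants Hs χ X p) :
    SmoothFormOn (thetaZero χ X p) χ.source :=
  .sub (smoothFormOn_dform h.invariants.1)
    (.sum fun i => .smul (h.contMDiffOn_p1 i) (smoothFormOn_dform (contMDiffOn_xfun χ i)))

variable [FiniteDimensional ℝ E]

theorem contMDiffOn_inv_aFun (h : HasInvariants Hs χ X p) (i : Fin n) :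
    ContMDiffOn 𝓘(ℝ, E) 𝓘(ℝ, ℝ) ∞ (fun q => (aFun χ X p i q)⁻¹) χ.source :=
  (h.contMDiffOn_aFun i).inv₀ fun _ hq => h.aFun_ne_zero hq i

theorem smoothFormOn_piForm (h : HasInvariants Hs χ X p) (i : Fin n) :
    SmoothFormOn (piForm χ X p i) χ.source :=
  .smul (h.contMDiffOn_inv_aFun i) (.sub (smoothFormOn_dform (h.contMDiffOn_p2 _ _))
    (.sum fun j => .smul (contMDiffOn_der χ.open_source (h.adapted.smooth j)
      (h.contMDiffOn_p2 _ _)) (smoothFormOn_dform (contMDiffOn_xfun χ j))))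

theorem smoothFormOn_thetaForm (h : HasInvariants Hs χ X p) (i : Fin n) :
    SmoothFormOn (thetaForm χ X p i) χ.source :=
  .smul (h.contMDiffOn_inv_aFun i).neg (.sub (smoothFormOn_dform (h.contMDiffOn_p1 i))
    (.sum fun j => .smul (h.contMDiffOn_p2 _ _) (smoothFormOn_dform (contMDiffOn_xfun χ j))))

theorem mem_total_iff_theta (h : HasInvariants Hs χ X p) (hq : q ∈ χ.source)
    (v : TangentSpace 𝓘(ℝ, E) q) :
    v ∈ total Hs q ↔ thetaZero χ X p q v = 0 ∧ ∀ i, thetaForm χ X p i q v = 0 := by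
  rw [h.isJetSystem.mem_iff hq]
  simp only [thetaZero_apply, thetaForm_apply, mul_eq_zero, neg_eq_zero, inv_eq_zero,
    h.aFun_ne_zero hq, false_or, sub_eq_zero]

theorem extDCongr_thetaZero (h : HasInvariants Hs χ X p) :
    ExtDCongr (total Hs) χ.source (thetaZero χ X p) (fun _ _ _ => 0) := by
  have : CompleteSpace E := FiniteDimensional.complete ℝ E
  intro q hq Y Z hY hZ
  rw [extD_of_mem χ.open_source (fun q' hq' v hv => ((h.mem_total_iff_theta hq' v).1 hv).1)
    hq hY hZ, thetaZero_apply, h.isJetSystem.dform_u_bracket hq hY hZ]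
  simp

/-- On sections of H, dθ_i(Y, Z) = -θ_i [Y, Z], and the contact form of p_i takes the value a_i (π_i
∧ dx_i)(Y, Z) on the bracket. The normalisation -1/a_i of θ_i absorbs both the sign and the factor.
-/
theorem extDCongr_thetaForm (h : HasInvariants Hs χ X p) (i : Fin n) :
    ExtDCongr (total Hs) χ.source (thetaForm χ X p i)
      (wedge (piForm χ X p i) (dform (xfun χ i))) := by
  have : CompleteSpace E := FiniteDimensional.complete ℝ E
  intro q hq Y Z hY hZ
  rw [extD_of_mem χ.open_source (fun q' hq' v hv => ((h.mem_total_iff_theta hq' v).1 hv).2 i)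
    hq hY hZ, thetaForm_apply, (h.isJetFrameAt hq).dform_u₁_bracket h.isJetSystem hq hY hZ i,
    add_sub_cancel_left, wedge, neg_mul, neg_neg, inv_mul_cancel_left₀ (h.aFun_ne_zero hq i)]
  rfl

theorem piForm_X (h : HasInvariants Hs χ X p) (hq : q ∈ χ.source) (i j : Fin n) :
    piForm χ X p i q (X j q) = 0 := (h.isJetFrameAt hq).jetPi_T i j

theorem piForm_ddu (h : HasInvariants Hs χ X p) (hq : q ∈ χ.source) (i j : Fin n) :
    piForm χ X p i q (ddu χ j q) = if i = j then 1 else 0 := (h.isJetFrameAt hq).jetPi_V i j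

theorem exists_dp_ne_zero (h : HasInvariants Hs χ X p) (hq : q ∈ χ.source) :
    ∃ v : TangentSpace 𝓘(ℝ, E) q, (∀ i, dform (xfun χ i) q v = 0) ∧ dform p q v = 1 := by
  obtain ⟨v, hv⟩ := h.mfderiv_phi_surjective hq ((0, 1, 0, 0) : JDiag n)
  have hv' := (h.mfderiv_phi hq v).symm.trans hv
  exact ⟨v, fun i => congrFun (congrArg Prod.fst hv') i, congrArg (fun z => z.2.1) hv'⟩

/-- A linear relation is triangular on suitable vectors: X_j isolates the coefficient of dx_j,
∂/∂u_j that of π_j, then [∂/∂u_j, X_j] that of θ_j, and finally a vector with dx = 0, dp = 1 that of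
θ_0. -/
theorem linearIndependent_coframe (h : HasInvariants Hs χ X p) (hq : q ∈ χ.source) :
    LinearIndependent ℝ (Sum.elim (fun i : Fin n => dform (xfun χ i) q)
      (Sum.elim (fun i : Fin n => piForm χ X p i q)
        (Sum.elim (fun _ : Unit => thetaZero χ X p q)
          (fun i : Fin n => thetaForm χ X p i q)))) := by
  refine Fintype.linearIndependent_iff.2 fun c hc => ?_
  have hev : ∀ v : TangentSpace 𝓘(ℝ, E) q,
      ∑ i, c (.inl i) * dform (xfun χ i) q v + (∑ i, c (.inr (.inl i)) * piForm χ X p i q v +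
        (c (.inr (.inr (.inl ()))) * thetaZero χ X p q v +
          ∑ i, c (.inr (.inr (.inr i))) * thetaForm χ X p i q v)) = 0 := by
    intro v
    have := LinearMap.congr_fun hc v
    rw [LinearMap.sum_apply] at this
    simpa [Fintype.sum_sum_type] using this
  have hX := fun j => (h.mem_total_iff_theta hq _).1 (h.X_mem hq j)
  have hV := fun j => (h.mem_total_iff_theta hq _).1 (h.ddu_mem hq j)
  have c1 : ∀ j, c (.inl j) = 0 := fun j => by
    simpa [h.dx_X hq, h.piForm_X hq, (hX j).1, (hX j).2] using hev (X j q)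
  have c2 : ∀ j, c (.inr (.inl j)) = 0 := fun j => by
    simpa [dx_ddu χ hq, h.piForm_ddu hq, (hV j).1, (hV j).2] using hev (ddu χ j q)
  have c4 : ∀ j, c (.inr (.inr (.inr j))) = 0 := fun j => by
    have h1 := hev (bracket (ddu χ j) (X j) q)
    simpa [c1, c2, thetaZero_apply, thetaForm_apply, h.dx_bracket hq, h.dp_bracket hq,
      h.dp1_bracket hq, h.aFun_ne_zero hq] using h1
  have c3 : c (.inr (.inr (.inl ()))) = 0 := by
    obtain ⟨v, hv, hpv⟩ := h.exists_dp_ne_zero hq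
    simpa [c1, c2, c4, thetaZero_apply, hv, hpv] using hev v
  rintro (i | i | i | i)
  exacts [c1 i, c2 i, c3, c4 i]

end HasInvariants
end StructureEquations

/-! ### Contact system on an equation manifold, and the GDMZ criterion -/

section EquationManifold

variable {n : ℕ}

/-- The projection that forgets the pure second derivatives, as a continuous linear map. -/
noncomputable def toJ1L (n : ℕ) : JDiag n →L[ℝ] J1 n :=
  (ContinuousLinearMap.fst ℝ _ _).prod
    (((ContinuousLinearMap.fst ℝ _ _).comp (ContinuousLinearMap.snd ℝ _ _)).prod
      ((ContinuousLinearMap.fst ℝ _ _).comp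
        ((ContinuousLinearMap.snd ℝ _ _).comp (ContinuousLinearMap.snd ℝ _ _))))

theorem toJ1L_apply (z : JDiag n) : toJ1L n z = z.toJ1 := rfl

/-- The second derivatives `u_{ij}`, as functions on the equation manifold. -/
def uSym (F : Fin n → Fin n → J1 n → ℝ) (s : Sym2 (Fin n)) (z : JDiag n) : ℝ :=
  (equationParam F z).2.2.2 s

theorem uSym_self (F : Fin n → Fin n → J1 n → ℝ) (i : Fin n) (z : JDiag n) :
    uSym F s(i, i) z = z.2.2.2 i := by
  simp [uSym, equationParam]

theorem inf_ne_sup {i j : Fin n} (hij : i ≠ j) : (s(i, j)).inf ≠ (s(i, j)).sup := by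
  simpa using hij

theorem inf_lt_sup {i j : Fin n} (hij : i ≠ j) : (s(i, j)).inf < (s(i, j)).sup :=
  lt_of_le_of_ne (by simp) (inf_ne_sup hij)

/-- Passing to inf and sup covers both orders of the indices at once, since F is constrained only
for i < j. -/
theorem uSym_of_ne (F : Fin n → Fin n → J1 n → ℝ) {i j : Fin n} (hij : i ≠ j) :
    uSym F s(i, j) = fun z => F (s(i, j)).inf (s(i, j)).sup (toJ1L n z) := by
  funext z
  exact if_neg (inf_ne_sup hij)

variable {W : Set (J1 n)} {F : Fin n → Fin n → J1 n → ℝ}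

theorem isOpen_over (hW : IsOpen W) : IsOpen {z : JDiag n | z.toJ1 ∈ W} :=
  hW.preimage (toJ1L n).continuous

theorem contDiffOn_uSym (hF : ∀ i j, i < j → ContDiffOn ℝ ∞ (F i j) W)
    (s : Sym2 (Fin n)) : ContDiffOn ℝ ∞ (uSym F s) {z : JDiag n | z.toJ1 ∈ W} := by
  induction s using Sym2.ind with
  | _ i j =>
    by_cases hij : i = j
    · subst hij
      have : uSym F s(i, i) = fun z => z.2.2.2 i := funext (uSym_self F i)
      rw [this]
      fun_prop
    · rw [uSym_of_ne F hij]
      exact (hF _ _ (inf_lt_sup hij)).comp (toJ1L n).contDiff.contDiffOn fun z hz => hz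

theorem contDiffOn_equationParam (hF : ∀ i j, i < j → ContDiffOn ℝ ∞ (F i j) W) :
    ContDiffOn ℝ ∞ (equationParam F) {z : JDiag n | z.toJ1 ∈ W} := by
  have h4 : ContDiffOn ℝ ∞ (fun z (s : Sym2 (Fin n)) => uSym F s z)
      {z : JDiag n | z.toJ1 ∈ W} := contDiffOn_pi.2 (contDiffOn_uSym hF)
  have h1 : ContDiff ℝ ∞ (fun z : JDiag n => z.1) := by fun_prop
  have h2 : ContDiff ℝ ∞ (fun z : JDiag n => z.2.1) := by fun_prop
  have h3 : ContDiff ℝ ∞ (fun z : JDiag n => z.2.2.1) := by fun_prop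
  exact h1.contDiffOn.prodMk (h2.contDiffOn.prodMk (h3.contDiffOn.prodMk h4))

theorem dform_eq_fderiv (f : JDiag n → ℝ) (z v : JDiag n) :
    dform (E := JDiag n) f z v = fderiv ℝ f z v :=
  congrArg (fun L : JDiag n →L[ℝ] ℝ => L v) mfderiv_eq_fderiv

theorem dform_eq_of_clm (L : JDiag n →L[ℝ] ℝ) (z v : JDiag n) :
    dform (E := JDiag n) (fun z => L z) z v = L v := by
  rw [dform_eq_fderiv]
  exact congrArg (fun L : JDiag n →L[ℝ] ℝ => L v) L.fderiv

theorem dform_coord_x (i : Fin n) (z v : JDiag n) :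
    dform (E := JDiag n) (fun z : JDiag n => z.1 i) z v = v.1 i :=
  dform_eq_of_clm ((ContinuousLinearMap.proj i).comp (ContinuousLinearMap.fst ℝ _ _)) z v

theorem dform_coord_u (z v : JDiag n) :
    dform (E := JDiag n) (fun z : JDiag n => z.2.1) z v = v.2.1 :=
  dform_eq_of_clm ((ContinuousLinearMap.fst ℝ _ _).comp (ContinuousLinearMap.snd ℝ _ _)) z v

theorem dform_coord_u₁ (i : Fin n) (z v : JDiag n) :
    dform (E := JDiag n) (fun z : JDiag n => z.2.2.1 i) z v = v.2.2.1 i :=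
  dform_eq_of_clm ((ContinuousLinearMap.proj i).comp ((ContinuousLinearMap.fst ℝ _ _).comp
    ((ContinuousLinearMap.snd ℝ _ _).comp (ContinuousLinearMap.snd ℝ _ _)))) z v

theorem dform_uSym_self (i : Fin n) (z v : JDiag n) :
    dform (E := JDiag n) (uSym F s(i, i)) z v = v.2.2.2 i := by
  have h : uSym F s(i, i) = fun z => z.2.2.2 i := funext (uSym_self F i)
  rw [h]
  exact dform_eq_of_clm ((ContinuousLinearMap.proj i).comp ((ContinuousLinearMap.snd ℝ _ _).comp
    ((ContinuousLinearMap.snd ℝ _ _).comp (ContinuousLinearMap.snd ℝ _ _)))) z v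

theorem dform_uSym_of_ne (hW : IsOpen W) (hF : ∀ i j, i < j → ContDiffOn ℝ ∞ (F i j) W)
    {i j : Fin n} (hij : i ≠ j) {z : JDiag n} (hz : z.toJ1 ∈ W) (v : JDiag n) :
    dform (E := JDiag n) (uSym F s(i, j)) z v =
      fderiv ℝ (F (s(i, j)).inf (s(i, j)).sup) z.toJ1 v.toJ1 := by
  rw [uSym_of_ne F hij, dform_eq_fderiv]
  have hd : DifferentiableAt ℝ (F (s(i, j)).inf (s(i, j)).sup) (toJ1L n z) :=
    ((hF _ _ (inf_lt_sup hij)).contDiffAt (hW.mem_nhds hz)).differentiableAt (by simp)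
  have := hd.hasFDerivAt.comp z (toJ1L n).hasFDerivAt
  exact congrArg (fun L : JDiag n →L[ℝ] ℝ => L v) this.fderiv

theorem mfderiv_equationParam (hW : IsOpen W) (hF : ∀ i j, i < j → ContDiffOn ℝ ∞ (F i j) W)
    {z : JDiag n} (hz : z.toJ1 ∈ W) (v : JDiag n) :
    mfderiv 𝓘(ℝ, JDiag n) 𝓘(ℝ, J2 n) (equationParam F) z v =
      ((v.1, v.2.1, v.2.2.1, fun s => dform (E := JDiag n) (uSym F s) z v) : J2 n) := by
  have hm : MDifferentiableAt 𝓘(ℝ, JDiag n) 𝓘(ℝ, J2 n) (equationParam F) z :=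
    (((contDiffOn_equationParam hF).contDiffAt ((isOpen_over hW).mem_nhds hz)).differentiableAt
      (by simp)).mdifferentiableAt
  have hd := fun L => dform_clm_comp hm L v
  let π₁ := ContinuousLinearMap.fst ℝ (Fin n → ℝ) (ℝ × (Fin n → ℝ) × (Sym2 (Fin n) → ℝ))
  let π₂ := ContinuousLinearMap.snd ℝ (Fin n → ℝ) (ℝ × (Fin n → ℝ) × (Sym2 (Fin n) → ℝ))
  let π₃ := ContinuousLinearMap.snd ℝ ℝ ((Fin n → ℝ) × (Sym2 (Fin n) → ℝ))
  refine Prod.ext (funext fun i => ?_) (Prod.ext ?_ (Prod.ext (funext fun i => ?_)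
    (funext fun s => ?_)))
  · exact (hd ((ContinuousLinearMap.proj i).comp π₁)).symm.trans (dform_coord_x i z v)
  · exact (hd ((ContinuousLinearMap.fst ℝ _ _).comp π₂)).symm.trans (dform_coord_u z v)
  · exact (hd ((ContinuousLinearMap.proj i).comp
      ((ContinuousLinearMap.fst ℝ _ _).comp (π₃.comp π₂)))).symm.trans (dform_coord_u₁ i z v)
  · exact (hd ((ContinuousLinearMap.proj s).comp
      ((ContinuousLinearMap.snd ℝ _ _).comp (π₃.comp π₂)))).symm

theorem mem_equationDistribution (hW : IsOpen W)
    (hF : ∀ i j, i < j → ContDiffOn ℝ ∞ (F i j) W) {z : JDiag n} (hz : z.toJ1 ∈ W)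
    (v : JDiag n) : v ∈ equationDistribution F z ↔
      v.2.1 = ∑ i, z.2.2.1 i * v.1 i ∧ ∀ i, v.2.2.1 i = ∑ j, uSym F s(i, j) z * v.1 j := by
  have h : v ∈ equationDistribution F z ↔
      mfderiv 𝓘(ℝ, JDiag n) 𝓘(ℝ, J2 n) (equationParam F) z v ∈
        contact n (equationParam F z) := Iff.rfl
  rw [h, mfderiv_equationParam hW hF hz]
  exact Iff.rfl

theorem isJetSystem_equation (hW : IsOpen W) (hF : ∀ i j, i < j → ContDiffOn ℝ ∞ (F i j) W) :
    IsJetSystem (equationDistribution F) {z : JDiag n | z.toJ1 ∈ W}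
      (fun i z => z.1 i) (fun z => z.2.1) (fun i z => z.2.2.1 i) (uSym F) where
  isOpen := isOpen_over hW
  smooth_x i := ContDiffOn.contMDiffOn (by fun_prop)
  smooth_u := ContDiffOn.contMDiffOn (by fun_prop)
  smooth_u₁ i := ContDiffOn.contMDiffOn (by fun_prop)
  smooth_u₂ s := (contDiffOn_uSym hF s).contMDiffOn
  contact_of_mem z hz v hv := by
    obtain ⟨h0, h1⟩ := (mem_equationDistribution hW hF hz v).1 hv
    have hx := fun i => dform_coord_x i z v
    exact ⟨(dform_coord_u z v).trans (h0.trans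
        (Finset.sum_congr rfl fun i _ => congrArg _ (hx i).symm)),
      fun i => (dform_coord_u₁ i z v).trans ((h1 i).trans
        (Finset.sum_congr rfl fun j _ => congrArg _ (hx j).symm))⟩
  mem_of_contact z hz v h0 h1 := by
    have hx := fun i => dform_coord_x i z v
    exact (mem_equationDistribution hW hF hz v).2 ⟨(dform_coord_u z v).symm.trans (h0.trans
        (Finset.sum_congr rfl fun i _ => congrArg _ (hx i))),
      fun i => (dform_coord_u₁ i z v).symm.trans ((h1 i).trans
        (Finset.sum_congr rfl fun j _ => congrArg _ (hx j)))⟩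

/-- The total derivative `∂/∂x_k + u_k ∂/∂u + ∑ u_{lk} ∂/∂u_l`, at the point `z`. -/
def totalD (F : Fin n → Fin n → J1 n → ℝ) (k : Fin n) (z : JDiag n) : J1 n :=
  (Pi.single k 1, z.2.2.1 k, fun l => uSym F s(l, k) z)

/-- The lift of the total derivative with the components `c` in the directions `∂/∂u_{ll}`. -/
def liftD (F : Fin n → Fin n → J1 n → ℝ) (c : Fin n → ℝ) (k : Fin n) : VField (JDiag n) (JDiag n) :=
  fun z => ((Pi.single k 1, z.2.2.1 k, fun l => uSym F s(l, k) z, c) : JDiag n)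

/-- The contact conditions leave the ∂/∂u_ll components free. Constant ones suffice, because a frame
only prescribes them at one point. -/
theorem isLocalSection_liftD (hW : IsOpen W) (hF : ∀ i j, i < j → ContDiffOn ℝ ∞ (F i j) W)
    {z : JDiag n} (hz : z.toJ1 ∈ W) (c : Fin n → ℝ) (k : Fin n) :
    IsLocalSection (equationDistribution F) z (liftD F c k) := by
  refine ⟨_, isOpen_over hW, hz, fun y hy => ?_, fun y hy => ?_⟩
  · refine contMDiffWithinAt_vectorSpace_iff_contDiffWithinAt.2 ?_
    have h4 : ContDiffOn ℝ ∞ (fun z l => uSym F s(l, k) z)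
      {z : JDiag n | z.toJ1 ∈ W} := contDiffOn_pi.2 fun l => contDiffOn_uSym hF s(l, k)
    have h3 : ContDiff ℝ ∞ (fun z : JDiag n => z.2.2.1 k) := by fun_prop
    exact ContDiffOn.prodMk contDiffOn_const (h3.contDiffOn.prodMk
      (h4.prodMk contDiffOn_const)) y hy
  · refine (mem_equationDistribution hW hF hy _).2 ⟨?_, fun i => ?_⟩
    · change y.2.2.1 k = ∑ i, y.2.2.1 i * (Pi.single k 1 : Fin n → ℝ) i
      simp [Pi.single_apply]
    · change uSym F s(i, k) y = ∑ j, uSym F s(i, j) y * (Pi.single k 1 : Fin n → ℝ) j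
      simp [Pi.single_apply]

/-- The coordinate vector `∂/∂u_{kk}`. -/
def vertical (k : Fin n) : VField (JDiag n) (JDiag n) :=
  fun _ => ((0, 0, 0, Pi.single k 1) : JDiag n)

theorem isLocalSection_vertical (hW : IsOpen W) (hF : ∀ i j, i < j → ContDiffOn ℝ ∞ (F i j) W)
    {z : JDiag n} (hz : z.toJ1 ∈ W) (k : Fin n) :
    IsLocalSection (equationDistribution F) z (vertical k) := by
  refine ⟨_, isOpen_over hW, hz, fun y hy => ?_, fun y hy => ?_⟩
  · exact contMDiffWithinAt_vectorSpace_iff_contDiffWithinAt.2 contDiffWithinAt_const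
  · refine (mem_equationDistribution hW hF hy _).2 ⟨?_, fun i => ?_⟩
    · change (0 : ℝ) = ∑ i, y.2.2.1 i * (0 : ℝ)
      simp
    · change (0 : ℝ) = ∑ j, uSym F s(i, j) y * (0 : ℝ)
      simp

/-- The compatibility conditions `D_k F_{ij} = D_j F_{ik}` make the system
`u_{ij} = F_{ij}(x, u, ∇u)` a GDMZ system. -/
theorem isGDMZ_of_compatible (hn : 1 ≤ n) (hW : IsOpen W)
    (hF : ∀ i j, i < j → ContDiffOn ℝ ∞ (F i j) W)
    (hcomp : ∀ z : JDiag n, z.toJ1 ∈ W → ∀ i j k, i ≠ j → i ≠ k → j ≠ k →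
      fderiv ℝ (F (s(i, j)).inf (s(i, j)).sup) z.toJ1 (totalD F k z) =
        fderiv ℝ (F (s(i, k)).inf (s(i, k)).sup) z.toJ1 (totalD F j z)) :
    IsGDMZ W F := by
  refine ⟨hW, hF, fun z hz => ?_⟩
  -- The ∂/∂u_ii component of T_k is chosen as D_i F_ik, which forces T_k u_ii = T_i u_ik. The entry
  -- with i = k is a dummy value on which no condition falls.
  let c : Fin n → Fin n → ℝ := fun k i =>
    fderiv ℝ (F (s(i, k)).inf (s(i, k)).sup) z.toJ1 (totalD F i z)
  have hne : ∀ i j k, i ≠ j → dform (E := JDiag n) (uSym F s(i, j)) z (liftD F (c k) k z) =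
      fderiv ℝ (F (s(i, j)).inf (s(i, j)).sup) z.toJ1 (totalD F k z) :=
    fun i j k hij => dform_uSym_of_ne hW hF hij hz _
  have hself : ∀ i k, dform (E := JDiag n) (uSym F s(i, i)) z (liftD F (c k) k z) = c k i :=
    fun i k => dform_uSym_self i z _
  have hframe : IsJetFrameAt (equationDistribution F) (fun i z => z.1 i) (fun z => z.2.1)
      (fun i z => z.2.2.1 i) (uSym F) z (fun k => liftD F (c k) k) vertical
      (fun k => ((0, 0, Pi.single k 1, 0) : JDiag n)) (fun _ => 1) :=
    { section_T := fun k => isLocalSection_liftD hW hF hz (c k) k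
      section_V := fun k => isLocalSection_vertical hW hF hz k
      dx_T := fun i j => by
        refine (dform_coord_x j z _).trans ?_
        simp [liftD, Pi.single_apply, eq_comm]
      dx_V := fun i j => dform_coord_x j z _
      mem_span_V := fun (v : JDiag n) hv hx => by
        have hx' : ∀ i, v.1 i = 0 := fun i => (dform_coord_x i z v).symm.trans (hx i)
        have hv' := (mem_equationDistribution hW hF hz v).1 hv
        simp only [hx', mul_zero, Finset.sum_const_zero] at hv'
        refine (Submodule.mem_span_range_iff_exists_fun ℝ).2 ⟨v.2.2.2, ?_⟩
        change (∑ k, v.2.2.2 k • ((0, 0, 0, Pi.single k 1) : JDiag n)) = v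
        refine Prod.ext (funext fun i => ?_) (Prod.ext ?_ (Prod.ext (funext fun i => ?_)
          (funext fun i => ?_)))
        · simp [Prod.fst_sum, hx']
        · simp [Prod.snd_sum, Prod.fst_sum, hv'.1]
        · simp [Prod.snd_sum, Prod.fst_sum, hv'.2]
        · simp [Prod.snd_sum, Finset.sum_apply, Pi.single_apply]
      -- If i equals j or k, symmetry holds by the choice of `c`; for distinct indices it is the
      -- compatibility condition.
      du₂_T := fun i j k => by
        by_cases hjk : j = k
        · rw [hjk]
        by_cases hij : i = j
        · subst hij
          rw [hself, hne i k i hjk]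
        by_cases hik : i = k
        · subst hik
          rw [hself, hne i j i hij]
        · rw [hne i j k hij, hne i k j hik, hcomp z hz i j k hij hik hjk]
      du₂_V := fun s k => by
        induction s using Sym2.ind with
        | _ i j =>
          by_cases hij : i = j
          · subst hij
            refine (dform_uSym_self i z _).trans ?_
            simp [vertical, Pi.single_apply]
          · refine (dform_uSym_of_ne hW hF hij hz _).trans ?_
            have h0 : JDiag.toJ1 (vertical k z : JDiag n) = 0 := rfl
            rw [h0, map_zero, if_neg]
            simp only [Sym2.eq_iff, or_self, not_and]
            exact fun hi hj => hij (hi.trans hj.symm)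
      a_ne := fun _ => one_ne_zero
      dx_B := fun i j => dform_coord_x j z _
      du_B := fun i => dform_coord_u z _
      du₁_B := fun i j => by
        refine (dform_coord_u₁ j z _).trans ?_
        simp [Pi.single_apply, eq_comm] }
  exact hframe.isInvolutiveAt (isJetSystem_equation hW hF) hz hn

end EquationManifold

/-! ### The image of Φ as an open part of an equation manifold -/

section LocalEquation

variable {n : ℕ}

/-- The point `(x_i, u, u_i, u_{ii})` of a 2-jet. -/
def diagPart (z : J2 n) : JDiag n := (z.1, z.2.1, z.2.2.1, fun i => z.2.2.2 s(i, i))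

theorem diagPart_equationParam (F : Fin n → Fin n → J1 n → ℝ) (w : JDiag n) :
    diagPart (equationParam F w) = w := by
  refine Prod.ext rfl (Prod.ext rfl (Prod.ext rfl (funext fun i => ?_)))
  exact uSym_self F i w

theorem eq_equationParam_diagPart {W : Set (J1 n)} {F : Fin n → Fin n → J1 n → ℝ} {z : J2 n}
    (hz : z ∈ equationManifold W F) : z = equationParam F (diagPart z) := by
  rw [← equationParam_image] at hz
  obtain ⟨w, -, rfl⟩ := hz
  rw [diagPart_equationParam]

theorem continuous_diagPart : Continuous (diagPart (n := n)) := by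
  unfold diagPart
  fun_prop

/-- The point with first-order part `w` and pure second derivatives `t`. -/
def joinDiag (w : J1 n) (t : Fin n → ℝ) : JDiag n := (w.1, w.2.1, w.2.2, t)

/-- Products carry the sup metric, so a ball is a product: a base of first-order jets times a ball
of pure second derivatives. -/
theorem joinDiag_mem_ball {w w₀ : J1 n} {t t₀ : Fin n → ℝ} {r : ℝ} :
    joinDiag w t ∈ Metric.ball (joinDiag w₀ t₀) r ↔
      w ∈ Metric.ball w₀ r ∧ t ∈ Metric.ball t₀ r := by
  simp only [joinDiag, Metric.mem_ball, Prod.dist_eq, max_lt_iff, and_assoc]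

/-- An identity between first-order expressions that is affine in the pure second derivatives holds
everywhere if it holds on a ball. -/
theorem compatible_of_ball {F : Fin n → Fin n → J1 n → ℝ} {j k : Fin n} (hjk : j ≠ k)
    {w : J1 n} {A A' : J1 n →L[ℝ] ℝ} {t₀ : Fin n → ℝ} {r : ℝ} (hr : 0 < r)
    (h : ∀ t ∈ Metric.ball t₀ r,
      A (totalD F k (joinDiag w t)) = A' (totalD F j (joinDiag w t))) (t : Fin n → ℝ) :
    A (totalD F k (joinDiag w t)) = A' (totalD F j (joinDiag w t)) := by
  -- Among the pure second derivatives D_k contains only u_kk, as coefficient of ∂/∂u_k; the mixed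
  -- ones depend on `w` alone.
  have hshift : ∀ (k : Fin n) (t : Fin n → ℝ), totalD F k (joinDiag w t) =
      totalD F k (joinDiag w t₀) + (t k - t₀ k) • ((0, 0, Pi.single k 1) : J1 n) := by
    intro k t
    refine Prod.ext ?_ (Prod.ext ?_ (funext fun l => ?_))
    · simp [totalD]
    · simp [totalD, joinDiag]
    · by_cases hl : l = k
      · subst hl
        simp [totalD, joinDiag, uSym_self]
      · simp [totalD, uSym_of_ne F hl, hl, toJ1L_apply, joinDiag, JDiag.toJ1]
  have h0 := h t₀ (Metric.mem_ball_self hr)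
  have hstep : ∀ l : Fin n, t₀ + Pi.single l (r / 2) ∈ Metric.ball t₀ r := fun l => by
    rw [mem_ball_iff_norm, add_sub_cancel_left, Pi.norm_single, Real.norm_eq_abs,
      abs_of_pos (half_pos hr)]
    exact half_lt_self hr
  have h1 := h _ (hstep k)
  have h2 := h _ (hstep j)
  rw [hshift k, hshift j, map_add, map_add, map_smul, map_smul] at h1 h2 ⊢
  have hr2 : r / 2 ≠ 0 := (half_pos hr).ne'
  -- As j ≠ k, moving only t_k changes the left side and not the right, so its coefficient is zero;
  -- moving t_j does the same for the right side. Both sides are then constant in `t`.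
  have hA : A (0, 0, Pi.single k 1) = 0 := by simpa [h0, hjk, hr.ne'] using h1
  have hA' : A' (0, 0, Pi.single j 1) = 0 := by simpa [h0, hjk.symm, hr.ne'] using h2
  rw [h0, hA, hA', smul_zero, smul_zero]

variable {E : Type*} [NormedAddCommGroup E] [NormedSpace ℝ E]
  {M : Type*} [TopologicalSpace M] [ChartedSpace E M] [IsManifold 𝓘(ℝ, E) ∞ M]

namespace HasInvariants

variable {Hs : Fin n → Distribution E M} {χ : CoordSystem n E M} {X : Fin n → VField E M}
  {p : M → ℝ} {q : M}

theorem dform_comp_phi (h : HasInvariants Hs χ X p) (hq : q ∈ χ.source) {g : JDiag n → ℝ}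
    (hg : DifferentiableAt ℝ g (phi χ X p q)) (v : TangentSpace 𝓘(ℝ, E) q) :
    dform (fun q' => g (phi χ X p q')) q v =
      dform (E := JDiag n) g (phi χ X p q)
        (mfderiv 𝓘(ℝ, E) 𝓘(ℝ, JDiag n) (phi χ X p) q v) :=
  congrArg (fun L : E →L[ℝ] ℝ => L v)
    (mfderiv_comp q hg.mdifferentiableAt (h.mdifferentiableAt_phi hq))

variable [FiniteDimensional ℝ E]

/-- In the coordinates φ, the directions ∂/∂u_ll of jet space are combinations of the ∂/∂u_k on M,
along which p_ij is constant for i ≠ j. So p_ij is a function F_ij of the first-order jet, and X_k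
p_ij = X_j p_ik becomes the compatibility condition. -/
theorem exists_isGDMZ (h : HasInvariants Hs χ X p) (hn : 1 ≤ n) (hq : q ∈ χ.source) :
    ∃ N : Set M, IsOpen N ∧ q ∈ N ∧ N ⊆ χ.source ∧
      ∃ (W : Set (J1 n)) (F : Fin n → Fin n → J1 n → ℝ), IsGDMZ W F ∧
        (∀ q' ∈ N, (phi χ X p q').toJ1 ∈ W ∧
          ∀ i j, i < j → p2 X p i j q' = F i j (phi χ X p q').toJ1) ∧
        InjOn (Phi χ X p) N ∧
        ∃ O : Set (J2 n), IsOpen O ∧ Phi χ X p '' N = O ∩ equationManifold W F := by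
  obtain ⟨Ψ, hqΨ, heq⟩ := h.isLocalDiffeomorphOn_phi ⟨q, hq⟩
  change q ∈ Ψ.source at hqΨ
  set w₀ : J1 n := (phi χ X p q).toJ1 with hw₀
  set t₀ : Fin n → ℝ := (phi χ X p q).2.2.2 with ht₀
  have hz₀ : phi χ X p q = joinDiag w₀ t₀ := rfl
  have hΩ : IsOpen (Ψ.target ∩ Ψ.symm ⁻¹' χ.source) :=
    Ψ.contMDiffOn_invFun.continuousOn.isOpen_inter_preimage Ψ.open_target χ.open_source
  have hz₀Ω : joinDiag w₀ t₀ ∈ Ψ.target ∩ Ψ.symm ⁻¹' χ.source := by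
    rw [← hz₀, heq hqΨ]
    refine ⟨Ψ.map_source hqΨ, ?_⟩
    have : Ψ.symm (Ψ q) = q := Ψ.left_inv hqΨ
    rw [mem_preimage, this]
    exact hq
  obtain ⟨r, hr, hball⟩ := Metric.isOpen_iff.1 hΩ _ hz₀Ω
  -- the inverse of `φ` on the ball
  have hinv : ∀ z ∈ Metric.ball (joinDiag w₀ t₀) r, Ψ.symm z ∈ χ.source ∧
      Ψ.symm z ∈ Ψ.source ∧ phi χ X p (Ψ.symm z) = z := by
    intro z hz
    have hs : Ψ.symm z ∈ Ψ.source := Ψ.map_target (hball hz).1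
    exact ⟨(hball hz).2, hs, (heq hs).trans (Ψ.right_inv (hball hz).1)⟩
  have hleft : ∀ q' ∈ Ψ.source, Ψ.symm (phi χ X p q') = q' := fun q' hq' => by
    rw [heq hq']
    exact Ψ.left_inv hq'
  let N : Set M := (χ.source ∩ Ψ.source) ∩ phi χ X p ⁻¹' Metric.ball (joinDiag w₀ t₀) r
  have hN : IsOpen N := (h.contMDiffOn_phi.continuousOn.mono
    inter_subset_left).isOpen_inter_preimage (χ.open_source.inter Ψ.open_source)
      Metric.isOpen_ball
  let f : Fin n → Fin n → JDiag n → ℝ := fun i j z => p2 X p i j (Ψ.symm z)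
  have hf : ∀ i j, ContDiffOn ℝ ∞ (f i j) (Metric.ball (joinDiag w₀ t₀) r) := fun i j =>
    ((h.contMDiffOn_p2 i j).comp (Ψ.contMDiffOn_invFun.mono fun z hz => (hball hz).1)
      fun z hz => (hball hz).2).contDiffOn
  have hfd : ∀ i j, ∀ z ∈ Metric.ball (joinDiag w₀ t₀) r, DifferentiableAt ℝ (f i j) z :=
    fun i j z hz => ((hf i j).contDiffAt (Metric.isOpen_ball.mem_nhds hz)).differentiableAt
      (by simp)
  -- `f_{ij}` does not depend on the pure second derivatives
  have hvert : ∀ i j, i ≠ j → ∀ z ∈ Metric.ball (joinDiag w₀ t₀) r, ∀ s : Fin n → ℝ,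
      fderiv ℝ (f i j) z (0, 0, 0, s) = 0 := by
    intro i j hij z hz s
    obtain ⟨h1, h2, h3⟩ := hinv z hz
    obtain ⟨v, hv⟩ := h.mfderiv_phi_surjective h1 ((0, 0, 0, s) : JDiag n)
    have hv' := (h.mfderiv_phi h1 v).symm.trans hv
    have hx : ∀ k, dform (xfun χ k) (Ψ.symm z) v = 0 := fun k =>
      congrFun (congrArg Prod.fst hv') k
    have hp : dform p (Ψ.symm z) v = 0 := congrArg (fun z => z.2.1) hv'
    have hp₁ : ∀ k, dform (p1 X p k) (Ψ.symm z) v = 0 := fun k =>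
      congrFun (congrArg (fun z => z.2.2.1) hv') k
    -- All dx_k, dp and dp_k vanish on `v`, so the contact equations hold trivially. Thus `v` lies
    -- in H and, by dx = 0, in the span of the ∂/∂u_k.
    have hmem : v ∈ total Hs (Ψ.symm z) := (h.isJetSystem.mem_iff h1 v).2
      ⟨by simp [hx, hp], fun k => by simp [hx, hp₁]⟩
    have h0 : dform (p2 X p i j) (Ψ.symm z) v = 0 := by
      refine dform_eq_zero_of_mem_span (fun k => ?_) (h.mem_span_ddu h1 hmem hx)
      rw [← h.dform_pSym h1, h.dpSym_ddu h1, if_neg]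
      simp only [Sym2.eq_iff, or_self, not_and]
      exact fun hi hj => hij (hi.trans hj.symm)
    have hev : p2 X p i j =ᶠ[𝓝 (Ψ.symm z)] fun q' => f i j (phi χ X p q') := by
      filter_upwards [Ψ.open_source.mem_nhds h2] with q' hq'
      exact congrArg (p2 X p i j) (hleft q' hq').symm
    have hd : DifferentiableAt ℝ (f i j) (phi χ X p (Ψ.symm z)) := by
      rw [h3]; exact hfd i j z hz
    rw [dform_congr hev, h.dform_comp_phi h1 hd, hv, dform_eq_fderiv, h3] at h0
    exact h0
  have hindep : ∀ i j, i ≠ j → ∀ w ∈ Metric.ball w₀ r, ∀ t ∈ Metric.ball t₀ r,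
      f i j (joinDiag w t) = f i j (joinDiag w t₀) := by
    intro i j hij w hw t ht
    let ι : (Fin n → ℝ) →L[ℝ] JDiag n := (ContinuousLinearMap.inr ℝ _ _).comp
      ((ContinuousLinearMap.inr ℝ _ _).comp (ContinuousLinearMap.inr ℝ _ _))
    have hι : ∀ t, HasFDerivAt (joinDiag w) ι t := fun t => by
      have h1 : joinDiag w = fun t => joinDiag w 0 + ι t := by
        funext t
        simp [joinDiag, ι]
      rw [h1]
      exact ι.hasFDerivAt.const_add _
    have hd : ∀ t ∈ Metric.ball t₀ r, HasFDerivAt (fun t => f i j (joinDiag w t))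
        (0 : (Fin n → ℝ) →L[ℝ] ℝ) t := fun t ht => by
      have hz := joinDiag_mem_ball.2 ⟨hw, ht⟩
      have h1 := (hfd i j _ hz).hasFDerivAt.comp t (hι t)
      have h2 : (fderiv ℝ (f i j) (joinDiag w t)).comp ι = 0 := by
        ext1 s
        exact hvert i j hij _ hz s
      rw [h2] at h1
      exact h1
    exact (convex_ball t₀ r).is_const_of_fderivWithin_eq_zero (𝕜 := ℝ)
      (f := fun t => f i j (joinDiag w t))
      (fun t ht => (hd t ht).differentiableAt.differentiableWithinAt)
      (fun t ht => by
        rw [fderivWithin_of_isOpen Metric.isOpen_ball ht, (hd t ht).fderiv])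
      ht (Metric.mem_ball_self hr)
  -- Freezing the pure second derivatives at their centre value gives a function of the first-order
  -- jet, equal to `f` on the ball for i ≠ j.
  let F : Fin n → Fin n → J1 n → ℝ := fun i j w => f i j (joinDiag w t₀)
  have hF : ∀ i j, i < j → ContDiffOn ℝ ∞ (F i j) (Metric.ball w₀ r) := by
    intro i j _
    refine (hf i j).comp (ContDiff.contDiffOn ?_) fun w hw =>
      joinDiag_mem_ball.2 ⟨hw, Metric.mem_ball_self hr⟩
    unfold joinDiag
    fun_prop
  have hNW : ∀ q' ∈ N, (phi χ X p q').toJ1 ∈ Metric.ball w₀ r ∧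
      (phi χ X p q').2.2.2 ∈ Metric.ball t₀ r := fun q' hq' => joinDiag_mem_ball.1 hq'.2
  have hNF : ∀ q' ∈ N, ∀ i j, i ≠ j → p2 X p i j q' = F i j (phi χ X p q').toJ1 := by
    intro q' hq' i j hij
    have h1 := hindep i j hij _ (hNW q' hq').1 _ (hNW q' hq').2
    have h2 : f i j (phi χ X p q') = p2 X p i j q' := congrArg (p2 X p i j) (hleft q' hq'.1.2)
    exact h2.symm.trans h1
  have hsym : ∀ q' ∈ N, ∀ s, pSym X p s q' = uSym F s (phi χ X p q') := by
    intro q' hq' s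
    induction s using Sym2.ind with
    | _ i j =>
      by_cases hij : i = j
      · subst hij
        rw [uSym_self, ← p2_self_eq]
        rfl
      · rw [uSym_of_ne F hij]
        exact hNF q' hq' _ _ (inf_ne_sup hij)
  -- The first-order part of dφ(X_k) is the total derivative D_k, so D_k F_ij pulls back to X_k
  -- p_ij.
  have hcompN : ∀ q' ∈ N, ∀ i j k, i ≠ j →
      fderiv ℝ (F (s(i, j)).inf (s(i, j)).sup) (phi χ X p q').toJ1
        (totalD F k (phi χ X p q')) = dform (pSym X p s(i, j)) q' (X k q') := by
    intro q' hq' i j k hij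
    have hev : pSym X p s(i, j) =ᶠ[𝓝 q'] fun q' => uSym F s(i, j) (phi χ X p q') := by
      filter_upwards [hN.mem_nhds hq'] with y hy using hsym y hy _
    have hd : DifferentiableAt ℝ (uSym F s(i, j)) (phi χ X p q') :=
      ((contDiffOn_uSym hF s(i, j)).contDiffAt
        ((isOpen_over Metric.isOpen_ball).mem_nhds (hNW q' hq').1)).differentiableAt (by simp)
    rw [dform_congr hev, h.dform_comp_phi hq'.1.1 hd]
    refine Eq.symm ((dform_uSym_of_ne Metric.isOpen_ball hF hij (hNW q' hq').1 _).trans ?_)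
    refine congrArg _ ?_
    rw [h.mfderiv_phi hq'.1.1]
    refine Prod.ext (funext fun l => ?_) (Prod.ext rfl (funext fun l => ?_))
    · refine (h.dx_X hq'.1.1 k l).trans ?_
      simp [totalD, Pi.single_apply, eq_comm]
    · exact (h.pSym_eq hq'.1.1 l k).symm.trans (hsym q' hq' s(l, k))
  -- Involutivity is required on the whole fibre over each point of W, whereas φ(N) only meets a
  -- ball of it. Affineness in the u_ll bridges the gap.
  have hGDMZ : IsGDMZ (Metric.ball w₀ r) F := by
    refine isGDMZ_of_compatible hn Metric.isOpen_ball hF fun z hz i j k hij hik hjk => ?_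
    refine compatible_of_ball (w := z.toJ1) (t₀ := t₀) hjk hr (fun t ht => ?_) z.2.2.2
    have hzb := joinDiag_mem_ball.2 ⟨hz, ht⟩
    obtain ⟨h1, h2, h3⟩ := hinv _ hzb
    have hmem : Ψ.symm (joinDiag z.toJ1 t) ∈ N := ⟨⟨h1, h2⟩, by rw [mem_preimage, h3]; exact hzb⟩
    have e1 := hcompN _ hmem i j k hij
    have e2 := hcompN _ hmem i k j hik
    rw [h3] at e1 e2
    exact e1.trans (((h.isJetFrameAt h1).du₂_T i j k).trans e2.symm)
  have hdiag : ∀ q', diagPart (Phi χ X p q') = phi χ X p q' := by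
    intro q'
    refine Prod.ext rfl (Prod.ext rfl (Prod.ext rfl (funext fun i => ?_)))
    exact (congrFun (p2_self_eq X p i) q').symm
  have hPhi : ∀ q' ∈ N, Phi χ X p q' ∈ equationManifold (Metric.ball w₀ r) F := by
    intro q' hq'
    refine ⟨(hNW q' hq').1, fun i j hij => ?_⟩
    exact (h.pSym_eq hq'.1.1 i j).trans (hNF q' hq' i j hij.ne)
  refine ⟨N, hN, ⟨⟨hq, hqΨ⟩, ?_⟩, fun _ hy => hy.1.1, Metric.ball w₀ r, F, hGDMZ,
    fun q' hq' => ⟨(hNW q' hq').1, fun i j hij => hNF q' hq' i j hij.ne⟩, ?_,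
    -- A point of the equation manifold is determined by its part (x, u, u_i, u_ii), so this
    -- condition cuts out exactly Φ(N).
    diagPart ⁻¹' Metric.ball (joinDiag w₀ t₀) r,
    Metric.isOpen_ball.preimage continuous_diagPart, ?_⟩
  · rw [mem_preimage, hz₀]
    exact Metric.mem_ball_self hr
  · intro y hy y' hy' he
    have h1 := congrArg diagPart he
    rw [hdiag, hdiag] at h1
    rw [← hleft y hy.1.2, h1, hleft y' hy'.1.2]
  · ext z
    constructor
    · rintro ⟨q', hq', rfl⟩
      refine ⟨?_, hPhi q' hq'⟩
      rw [mem_preimage, hdiag]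
      exact hq'.2
    · rintro ⟨hz, hzF⟩
      obtain ⟨h1, h2, h3⟩ := hinv _ hz
      have hmem : Ψ.symm (diagPart z) ∈ N := ⟨⟨h1, h2⟩, by rw [mem_preimage, h3]; exact hz⟩
      refine ⟨_, hmem, ?_⟩
      rw [eq_equationParam_diagPart (hPhi _ hmem), hdiag, h3, ← eq_equationParam_diagPart hzF]

end HasInvariants
end LocalEquation

end NHyp

theorem mainTheorem1 {n : ℕ} (hn : 2 ≤ n)
    {E : Type*} [NormedAddCommGroup E] [NormedSpace ℝ E] [FiniteDimensional ℝ E]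
    {M : Type*} [TopologicalSpace M] [ChartedSpace E M] [IsManifold 𝓘(ℝ, E) ∞ M]
    (Hs : Fin n → Distribution E M) (hH : IsNHyperbolic Hs)
    (χ : CoordSystem n E M) (X : Fin n → VField E M) (hX : IsAdapted Hs χ X)
    (p : M → ℝ) (hp : SpansInvariants χ X p) :
    -- `𝒜` is an integrable distribution of rank `2n`
    ((∀ q ∈ χ.source, Module.finrank ℝ (calA χ X q) = 2 * n) ∧
      IsIntegrableOn (calA χ X) χ.source) ∧
    -- `(x, p, p_i, p_{ii})` are local coordinates
    IsLocalDiffeomorphOn 𝓘(ℝ, E) 𝓘(ℝ, JDiag n) ∞ (phi χ X p) χ.source ∧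
    -- `Φ` is an immersion into `J²`
    (ContMDiffOn 𝓘(ℝ, E) 𝓘(ℝ, J2 n) ∞ (Phi χ X p) χ.source ∧
      ∀ q ∈ χ.source, Function.Injective (dPhi χ X p q)) ∧
    -- `Φ` identifies `H` with the contact distribution
    (∀ q ∈ χ.source, total Hs q = (contact n (Phi χ X p q)).comap (dPhi χ X p q)) ∧
    -- locally, the image of `Φ` is an open part of the equation manifold of a GDMZ system whose
    -- right-hand sides are the `f_{ij}` as functions of `(x, p, p_k)` alone
    (∀ q ∈ χ.source, ∃ N : Set M, IsOpen N ∧ q ∈ N ∧ N ⊆ χ.source ∧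
      ∃ (W : Set (J1 n)) (F : Fin n → Fin n → J1 n → ℝ), IsGDMZ W F ∧
        (∀ q' ∈ N, (phi χ X p q').toJ1 ∈ W ∧
          ∀ i j, i < j → p2 X p i j q' = F i j (phi χ X p q').toJ1) ∧
        InjOn (Phi χ X p) N ∧
        ∃ O : Set (J2 n), IsOpen O ∧ Phi χ X p '' N = O ∩ equationManifold W F) ∧
    -- the structure equations, in a coframe `ω_i = dx_i, π_i, θ_0, …, θ_n`
    (∃ (π : Fin n → OneForm E M) (θ₀ : OneForm E M) (θ : Fin n → OneForm E M),
      (∀ i, SmoothFormOn (π i) χ.source) ∧ SmoothFormOn θ₀ χ.source ∧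
      (∀ i, SmoothFormOn (θ i) χ.source) ∧
      (∀ q ∈ χ.source,
        LinearIndependent ℝ (Sum.elim (fun i : Fin n => dform (xfun χ i) q)
          (Sum.elim (fun i : Fin n => π i q)
            (Sum.elim (fun _ : Unit => θ₀ q) (fun i : Fin n => θ i q)))) ∧
        (∀ v, v ∈ total Hs q ↔ θ₀ q v = 0 ∧ ∀ i, θ i q v = 0) ∧
        (∀ i j, π i q (X j q) = 0 ∧ π i q (ddu χ j q) = if i = j then 1 else 0)) ∧
      ExtDCongr (total Hs) χ.source θ₀ (fun _ _ _ => 0) ∧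
      ∀ i, ExtDCongr (total Hs) χ.source (θ i) (wedge (π i) (dform (xfun χ i)))) ∧
    -- `H` with independence forms `dx_i` is involutive: zero torsion, and the only nonzero Cartan
    -- character is `s₁ = n`
    (∀ q ∈ χ.source,
      IsInvolutiveAt (total Hs) (fun i => dform (xfun χ i)) q ∧
      character (tableau (total Hs) (fun i => dform (xfun χ i)) q) 1 = n ∧
      ∀ k, 2 ≤ k → character (tableau (total Hs) (fun i => dform (xfun χ i)) q) k = 0) := by
  have h : HasInvariants Hs χ X p := ⟨hH, hX, hp⟩
  have : CompleteSpace E := FiniteDimensional.complete ℝ E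
  exact ⟨⟨fun q hq => h.finrank_calA hq, h.isIntegrableOn_calA⟩, h.isLocalDiffeomorphOn_phi,
    ⟨h.contMDiffOn_Phi, fun q hq => h.dPhi_injective hq⟩, fun q hq => h.total_eq_comap hq,
    fun q hq => h.exists_isGDMZ (by omega) hq,
    ⟨piForm χ X p, thetaZero χ X p, thetaForm χ X p, h.smoothFormOn_piForm,
      h.smoothFormOn_thetaZero, h.smoothFormOn_thetaForm,
      fun q hq => ⟨h.linearIndependent_coframe hq, h.mem_total_iff_theta hq,
        fun i j => ⟨h.piForm_X hq i j, h.piForm_ddu hq i j⟩⟩,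
      h.extDCongr_thetaZero, h.extDCongr_thetaForm⟩,
    fun q hq => ⟨(h.isJetFrameAt hq).isInvolutiveAt h.isJetSystem hq (by omega),
      (h.isJetFrameAt hq).character_one h.isJetSystem hq,
      fun k hk => (h.isJetFrameAt hq).character_of_two_le h.isJetSystem hq hk⟩⟩
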